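/- Let $n\ge 1$, $\mathcal O=\mathbb C[[t]]$, $\mathcal K=\mathbb C((t))$, and let $\mathcal G'=PGL_n(\mathcal K)/PGL_n(\mathcal O)$ be the affine Grassmannian of $PSL_n(\mathbb C)=PGL_n(\mathbb C)$, on which $SL_n(\mathcal K)$ acts. A gallery is a finite sequence $\gamma=(\underline{i}_1,\dots,\underline{i}_r)$ of nonempty strictly increasing sequences $\underline i_j$ of elements of $\{1,\dots,n\}$; equivalently it is a key tableau, whose $j$-th column counted from the right has the entries $\underline i_j$ from top to bottom. Its word $w_\gamma$ is the concatenation $\underline i_1\underline i_2\cdots\underline i_r$ (the tableau read column by column, starting with the right-most column, each column from top to bottom). For $\underline i=(i_1,\dots,i_d)$ put $\epsilon_{\underline i}=\epsilon_{i_1}+\dots+\epsilon_{i_d}$, regarded as a coweight, i.e. in $\mathbb Z^n/\mathbb Z(1,\dots,1)$, and let $\mu_j=\epsilon_{\underline i_1}+\dots+\epsilon_{\underline i_j}$ for $0\le j\le r$. For a coweight $\mu$ let $$\mathcal P_\mu=\{g\in SL_n(\mathcal K)\mid \text{the coefficient of } t^k \text{ in } g_{ab} \text{ is } 0 \text{ whenever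 } (\mu_a-\mu_b)+k<0\}$$ be the parahoric subgroup containing the root subgroups of the affine roots $(\alpha,k)$ with $(\alpha,\mu)+k\ge 0$, and denote again by $\mu\in\mathcal G'$ the point with stabilizer $\mathcal P_\mu$ given by the coset of the diagonal matrix $\mathrm{diag}(t^{-\mu_1},\dots,t^{-\mu_n})$. Put $\mathcal Q_j=\mathcal P_{\mu_j}\cap\mathcal P_{\mu_{j+1}}$ for $0\le j<r$. The Bott-Samelson variety (with center $\gamma$) is $$\Sigma=\mathcal P_{\mu_0}\times_{\mathcal Q_0}\mathcal P_{\mu_1}\times_{\mathcal Q_1}\cdots\times_{\mathcal Q_{r-1}}\mathcal P_{\mu_r}/\mathcal P_{\mu_r},$$ the quotient of $\mathcal P_{\mu_0}\times\dots\times\mathcal P_{\mu_r}$ by the action $(q_0,\dots,q_r)\circ(p_0,\dots,p_r)=(p_0q_0,\,q_0^{-1}p_1q_1,\dots,\,q_{r-1}^{-1}p_rq_r)$ of $\mathcal Q_0\times\dots\times\mathcal Q_{r-1}\times\mathcal P_{\mu_r}$, with its classical topology (the quotient topology, where the product of the $\mathcal P_{\mu_j}$ has the topology of coefficientwise convergence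 of matrix entries). Let $\pi:\Sigma\to\mathcal G'$, $[p_0,\dots,p_r]\mapsto p_0\cdots p_{r-1}.\mu_r$. Fix a generic anti-dominant one parameter subgroup $\eta:\mathbb C^*\to T$, $\eta(s)=\mathrm{diag}(s^{a_1},\dots,s^{a_n})$ with integers $a_1<\dots<a_n$, $\sum a_i=0$, acting on $\Sigma$ by $\eta(s).[p_0,p_1,\dots,p_r]=[\eta(s)p_0,p_1,\dots,p_r]$. The cell of $\gamma$ is $$C_\gamma=\{x\in\Sigma\mid \lim_{s\to 0}\eta(s).x=[1,\dots,1]\},$$ where $[1,\dots,1]$ is the torus fixed point corresponding to $\gamma$, and $Z_\gamma=\pi(C_\gamma)\subseteq\mathcal G'$. **Proposition.** The image $Z_\gamma$ depends only on the word $w_\gamma$: if $\gamma,\gamma'$ are galleries (possibly of different types) with $w_\gamma=w_{\gamma'}$, then $Z_\gamma=Z_{\gamma'}$. -/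

import Mathlib

noncomputable section

namespace LoopGallery

open Filter Topology
open scoped MatrixGroups

/-! ### Galleries (key tableaux) and words over the alphabet `Fin n` -/

/-- A column: a nonempty strictly increasing sequence of letters, listed from top to bottom. -/
def Column (n : ℕ) : Type := {l : List (Fin n) // l ≠ [] ∧ l.Pairwise (· < ·)}

/-- A gallery `γ = (i₁, …, i_r)`: a finite sequence of columns.  It is the same thing as the key
tableau whose `j`-th column, counted from right to left, is `i_j`. -/
abbrev Gallery (n : ℕ) : Type := List (Column n)

/-- The word of a gallery: the key tableau is read column by column, the right-most column first,
and each column is read from top to bottom. -/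
def Gallery.word {n : ℕ} (γ : Gallery n) : List (Fin n) := (γ.map Subtype.val).flatten

/-- The coweight `ε_{i₁} + … + ε_{i_d}` of a column.  Coweights are elements of
`ℤⁿ / ℤ (1, …, 1)`; we work with representatives in `ℤⁿ`. -/
def columnCoweight {n : ℕ} (c : Column n) : Fin n → ℤ := fun a => if a ∈ c.1 then 1 else 0

/-- The polyline of a gallery: its `j`-th vertex `μ_j` is the sum of the coweights of the first
`j` columns, for `j = 0, …, r`. -/
def vertex {n : ℕ} (γ : Gallery n) (j : ℕ) : Fin n → ℤ := ((γ.take j).map columnCoweight).sum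

/-! ### The loop group and the affine Grassmannian of `PSL_n` -/

/-- The ring of formal power series `ℂ[[t]]`. -/
abbrev 𝒪 : Type := PowerSeries ℂ

/-- The field of formal Laurent series `ℂ((t))`. -/
abbrev 𝒦 : Type := LaurentSeries ℂ

/-- The image of `GL_n(𝒪)` in the group `PGL_n(𝒦)` of `𝒦`-points of the adjoint group. -/
def adjointIntegral (n : ℕ) : Subgroup PGL(n, 𝒦) :=
  ((Matrix.ProjGenLinGroup.mk (n := Fin n) (R := 𝒦)).comp
    (Matrix.GeneralLinearGroup.map (algebraMap 𝒪 𝒦))).range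

/-- The affine Grassmannian `G'(𝒦) / G'(𝒪)` of the adjoint group `G' = PSL_n(ℂ) = PGL_n(ℂ)`. -/
abbrev AffineGrassmannian (n : ℕ) : Type := PGL(n, 𝒦) ⧸ adjointIntegral n

/-- The diagonal matrix `t^{-μ}`, with diagonal entries `t^{-μ_a}`. -/
def translation {n : ℕ} (μ : Fin n → ℤ) : GL (Fin n) 𝒦 where
  val := Matrix.diagonal fun a => HahnSeries.single (-μ a) 1
  inv := Matrix.diagonal fun a => HahnSeries.single (μ a) 1
  val_inv := by simp [Matrix.diagonal_mul_diagonal]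
  inv_val := by simp [Matrix.diagonal_mul_diagonal]

/-- The torus fixed point of the affine Grassmannian attached to a coweight: the coset of
`t^{-μ}`, whose stabilizer in `SL_n(𝒦)` is the parahoric subgroup of `μ`. -/
def coweightPoint {n : ℕ} (μ : Fin n → ℤ) : AffineGrassmannian n :=
  (QuotientGroup.mk (Matrix.ProjGenLinGroup.mk (translation μ)))

/-- `SL_n(𝒦)` acts on the affine Grassmannian of `PSL_n` through `SL_n(𝒦) → PGL_n(𝒦)`. -/
def loopAct {n : ℕ} (g : SL(n, 𝒦)) (x : AffineGrassmannian n) : AffineGrassmannian n :=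
  Matrix.SpecialLinearGroup.toPGL g • x

/-! ### Parahoric subgroups -/

/-- The entries of `g` only involve the affine roots `(ε_a - ε_b, k)` with
`(ε_a - ε_b, μ) + k ≥ 0`: the coefficient of `t^k` in the entry `(a, b)` vanishes otherwise. -/
def InParahoric {n : ℕ} (μ : Fin n → ℤ) (g : SL(n, 𝒦)) : Prop :=
  ∀ (a b : Fin n) (k : ℤ), (μ a - μ b) + k < 0 → (g a b).coeff k = 0

theorem exists_powerSeries_iff (m : ℤ) (f : 𝒦) :
    (∃ h : 𝒪, f = HahnSeries.single m 1 * algebraMap 𝒪 𝒦 h) ↔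
      ∀ k : ℤ, k < m → f.coeff k = 0 := by
  constructor
  · rintro ⟨h, rfl⟩ k hk
    rw [HahnSeries.coeff_single_mul, one_mul, LaurentSeries.coe_algebraMap]
    have hneg : k - m < 0 := by omega
    rw [HahnSeries.ofPowerSeries_apply]
    apply HahnSeries.embDomain_of_notMem_range
    rintro ⟨j, hj⟩
    simp at hj
    omega
  · intro hf
    refine ⟨PowerSeries.mk fun j => f.coeff (m + j), ?_⟩
    ext k
    rw [HahnSeries.coeff_single_mul, one_mul]
    by_cases hk : k < m
    · rw [hf k hk]
      symm
      rw [LaurentSeries.coe_algebraMap, HahnSeries.ofPowerSeries_apply]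
      apply HahnSeries.embDomain_of_notMem_range
      rintro ⟨j, hj⟩
      simp at hj
      omega
    · obtain ⟨j, hj⟩ := Int.eq_ofNat_of_zero_le (show 0 ≤ k - m by omega)
      rw [hj, LaurentSeries.coe_algebraMap, LaurentSeries.coeff_coe_powerSeries,
        PowerSeries.coeff_mk]
      congr 1
      omega

/-- An element satisfies the entrywise condition at `μ` exactly if it is conjugate under `t^{-μ}`
to an element of `SL_n(𝒪)`. -/
theorem inParahoric_iff {n : ℕ} (μ : Fin n → ℤ) (g : SL(n, 𝒦)) :
    InParahoric μ g ↔ ∃ h : SL(n, 𝒪),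
      Matrix.SpecialLinearGroup.toGL g * translation μ =
        translation μ * Matrix.SpecialLinearGroup.mapGL 𝒦 h := by
  have key : ∀ h : Matrix (Fin n) (Fin n) 𝒪,
      (g.1 * (translation μ).1 = (translation μ).1 * h.map (algebraMap 𝒪 𝒦)) ↔
        ∀ a b, g a b = HahnSeries.single (μ b - μ a) 1 * algebraMap 𝒪 𝒦 (h a b) := by
    intro h
    rw [← Matrix.ext_iff]
    refine forall_congr' fun a => forall_congr' fun b => ?_
    simp only [translation, Matrix.mul_diagonal, Matrix.diagonal_mul, Matrix.map_apply]
    have e1 : (HahnSeries.single (-μ b) (1 : ℂ)) * HahnSeries.single (μ b) 1 = 1 := by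
      simp
    have e2 : (HahnSeries.single (μ b) (1 : ℂ)) * HahnSeries.single (-μ a) 1 =
        HahnSeries.single (μ b - μ a) 1 := by
      simp [HahnSeries.single_mul_single, sub_eq_add_neg]
    rw [← e2]
    constructor
    · intro H
      calc g.1 a b = (g.1 a b * HahnSeries.single (-μ b) 1) * HahnSeries.single (μ b) 1 := by
            rw [mul_assoc, e1, mul_one]
        _ = _ := by rw [H]; ring
    · intro H
      change g.1 a b = _ at H
      rw [H]
      calc _ = HahnSeries.single (-μ a) 1 * algebraMap 𝒪 𝒦 (h a b) *
            (HahnSeries.single (-μ b) (1 : ℂ) * HahnSeries.single (μ b) 1) := by ring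
        _ = _ := by rw [e1, mul_one]
  constructor
  · intro hg
    have : ∀ a b, ∃ f : 𝒪, g a b = HahnSeries.single (μ b - μ a) 1 * algebraMap 𝒪 𝒦 f :=
      fun a b => (exists_powerSeries_iff _ _).2 fun k hk => hg a b k (by omega)
    choose f hf using this
    have hmat := (key (Matrix.of f)).2 hf
    have hdet : (Matrix.of f).det = 1 := by
      have h1 := congrArg Matrix.det hmat
      rw [Matrix.det_mul, Matrix.det_mul, g.2, one_mul] at h1
      have hu : ((translation μ).1).det ≠ 0 :=
        (((Matrix.isUnit_iff_isUnit_det _).1 (translation μ).isUnit)).ne_zero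
      have h2 : ((Matrix.of f).map (algebraMap 𝒪 𝒦)).det = 1 :=
        mul_left_cancel₀ hu (by rw [← h1, mul_one])
      have h3 : algebraMap 𝒪 𝒦 (Matrix.of f).det = algebraMap 𝒪 𝒦 1 := by
        rw [map_one, ← h2, RingHom.map_det]
        rfl
      exact IsFractionRing.injective 𝒪 𝒦 h3
    refine ⟨⟨Matrix.of f, hdet⟩, ?_⟩
    apply Units.ext
    exact hmat
  · rintro ⟨h, hh⟩ a b k hk
    have h1 := congrArg Units.val hh
    have h2 := (key h.1).1 h1 a b
    exact (exists_powerSeries_iff (μ b - μ a) (g a b)).1 ⟨_, h2⟩ k (by omega)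

/-- The parahoric subgroup `𝒫_μ` of `SL_n(𝒦)` attached to a coweight `μ`: it contains the torus
and the root subgroups of the affine roots that are nonnegative at `μ`. -/
def parahoric {n : ℕ} (μ : Fin n → ℤ) : Subgroup SL(n, 𝒦) where
  carrier := {g | InParahoric μ g}
  mul_mem' := by
    intro g g' hg hg'
    obtain ⟨h, hh⟩ := (inParahoric_iff _ _).1 hg
    obtain ⟨h', hh'⟩ := (inParahoric_iff _ _).1 hg'
    refine (inParahoric_iff _ _).2 ?_
    exact ⟨h * h', by rw [map_mul, map_mul, mul_assoc, hh', ← mul_assoc, hh, mul_assoc]⟩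
  one_mem' := (inParahoric_iff _ _).2 ⟨1, by simp⟩
  inv_mem' := by
    intro g hg
    obtain ⟨h, hh⟩ := (inParahoric_iff _ _).1 hg
    refine (inParahoric_iff _ _).2 ⟨h⁻¹, ?_⟩
    rw [map_inv, map_inv, inv_mul_eq_iff_eq_mul, ← mul_assoc, hh, mul_assoc, mul_inv_cancel,
      mul_one]

/-- `𝒫_μ` fixes the point of the affine Grassmannian attached to `μ`. -/
theorem loopAct_coweightPoint {n : ℕ} (μ : Fin n → ℤ) (g : SL(n, 𝒦)) (hg : g ∈ parahoric μ) :
    loopAct g (coweightPoint μ) = coweightPoint μ := by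
  obtain ⟨h, hh⟩ := (inParahoric_iff μ g).1 hg
  unfold loopAct coweightPoint
  change QuotientGroup.mk (Matrix.ProjGenLinGroup.mk (Matrix.SpecialLinearGroup.toGL g) *
    Matrix.ProjGenLinGroup.mk (translation μ)) = _
  rw [← map_mul, hh, map_mul]
  symm
  rw [QuotientGroup.eq, inv_mul_cancel_left]
  refine ⟨Matrix.SpecialLinearGroup.toGL h, ?_⟩
  refine congrArg Matrix.ProjGenLinGroup.mk (Units.ext ?_)
  ext a b
  simp [Matrix.SpecialLinearGroup.mapGL, Matrix.GeneralLinearGroup.map]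

/-! ### Bott-Samelson varieties -/

/-- The group `𝒬_j`: for `j < r` it is the parahoric subgroup of the segment `[μ_j, μ_{j+1}]`,
given by the affine roots that are nonnegative on the segment, i.e. at both end points; for
`j = r` it is `𝒫_{μ_r}`. -/
def segmentGroup {n : ℕ} (γ : Gallery n) (j : ℕ) : Subgroup SL(n, 𝒦) :=
  if j < γ.length then parahoric (vertex γ j) ⊓ parahoric (vertex γ (j + 1))
  else parahoric (vertex γ j)

/-- The product `𝒫_{μ_0} × 𝒫_{μ_1} × ⋯ × 𝒫_{μ_r}`. -/
def ParahoricProduct {n : ℕ} (γ : Gallery n) : Type :=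
  (j : Fin (γ.length + 1)) → parahoric (vertex γ j)

/-- The classical topology on `𝒫_{μ_0} × ⋯ × 𝒫_{μ_r}`, as a projective limit of complex varieties:
the coarsest topology for which all coefficients of all matrix entries are continuous functions
with values in `ℂ` (with its usual topology). -/
instance parahoricProductTopology {n : ℕ} (γ : Gallery n) :
    TopologicalSpace (ParahoricProduct γ) :=
  TopologicalSpace.induced
    (fun p (j : Fin (γ.length + 1)) (a b : Fin n) (k : ℤ) => ((p j : SL(n, 𝒦)) a b).coeff k)
    (inferInstance : TopologicalSpace (Fin (γ.length + 1) → Fin n → Fin n → ℤ → ℂ))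

/-- The orbit relation for
`(q_0, …, q_r) ∘ (p_0, …, p_r) = (p_0 q_0, q_0⁻¹ p_1 q_1, …, q_{r-1}⁻¹ p_r q_r)`, with
`q_j ∈ 𝒬_j` for `j < r` and `q_r ∈ 𝒫_{μ_r}`. -/
def BottSamelsonRel {n : ℕ} (γ : Gallery n) (p p' : ParahoricProduct γ) : Prop :=
  ∃ q : (j : Fin (γ.length + 1)) → segmentGroup γ j,
    (p' 0 : SL(n, 𝒦)) = p 0 * q 0 ∧
    ∀ j : Fin γ.length,
      (p' j.succ : SL(n, 𝒦)) = (q j.castSucc : SL(n, 𝒦))⁻¹ * p j.succ * q j.succ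

def bottSamelsonSetoid {n : ℕ} (γ : Gallery n) : Setoid (ParahoricProduct γ) where
  r := BottSamelsonRel γ
  iseqv :=
    { refl := fun p => ⟨fun _ => 1, by simp, fun j => by simp⟩
      symm := by
        rintro p p' ⟨q, h0, h⟩
        refine ⟨fun j => (q j)⁻¹, by rw [h0]; exact (mul_inv_cancel_right _ _).symm, fun j => ?_⟩
        rw [h j]
        simp [mul_assoc]
      trans := by
        rintro p p' p'' ⟨q, h0, h⟩ ⟨q', h0', h'⟩
        refine ⟨fun j => q j * q' j, by rw [h0', h0]; exact mul_assoc _ _ _, fun j => ?_⟩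
        rw [h' j, h j]
        simp [mul_assoc] }

/-- The Bott-Samelson variety
`Σ = 𝒫_{μ_0} ×_{𝒬_0} 𝒫_{μ_1} ×_{𝒬_1} ⋯ ×_{𝒬_{r-1}} 𝒫_{μ_r} / 𝒫_{μ_r}` with center `γ`, as the set
of complex points, endowed with the quotient topology, which is the classical topology of this
projective variety. -/
def BottSamelson {n : ℕ} (γ : Gallery n) : Type := Quotient (bottSamelsonSetoid γ)

/-- The class `[p_0, …, p_r]`. -/
def BottSamelson.mk {n : ℕ} {γ : Gallery n} (p : ParahoricProduct γ) : BottSamelson γ :=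
  Quotient.mk (bottSamelsonSetoid γ) p

instance bottSamelsonTopology {n : ℕ} (γ : Gallery n) : TopologicalSpace (BottSamelson γ) :=
  TopologicalSpace.coinduced BottSamelson.mk (parahoricProductTopology γ)

/-- The product `p_0 p_1 ⋯ p_{r-1}`. -/
def headProduct {n : ℕ} {γ : Gallery n} (p : ParahoricProduct γ) : SL(n, 𝒦) :=
  Fin.partialProd (fun j : Fin γ.length => (p j.castSucc : SL(n, 𝒦))) (Fin.last γ.length)

theorem loopAct_headProduct {n : ℕ} {γ : Gallery n} (p p' : ParahoricProduct γ)
    (hp : BottSamelsonRel γ p p') :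
    loopAct (headProduct p) (coweightPoint (vertex γ γ.length)) =
      loopAct (headProduct p') (coweightPoint (vertex γ γ.length)) := by
  obtain ⟨q, h0, h⟩ := hp
  have step : ∀ (m : ℕ) (hm : m < γ.length),
      Fin.partialProd (fun j : Fin γ.length => (p' j.castSucc : SL(n, 𝒦))) (Fin.succ ⟨m, hm⟩) =
      Fin.partialProd (fun j : Fin γ.length => (p j.castSucc : SL(n, 𝒦))) (Fin.succ ⟨m, hm⟩) *
        (q (Fin.castSucc ⟨m, hm⟩) : SL(n, 𝒦)) := by
    intro m
    induction m with
    | zero =>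
      intro hm
      rw [Fin.partialProd_succ, Fin.partialProd_succ]
      have e : Fin.castSucc (⟨0, hm⟩ : Fin γ.length) = 0 := rfl
      rw [e, Fin.partialProd_zero, Fin.partialProd_zero, one_mul, one_mul]
      exact h0
    | succ m ih =>
      intro hm
      have hm' : m < γ.length := by omega
      rw [Fin.partialProd_succ, Fin.partialProd_succ]
      have e : Fin.castSucc (⟨m + 1, hm⟩ : Fin γ.length) = Fin.succ ⟨m, hm'⟩ := rfl
      rw [e, ih hm', h ⟨m, hm'⟩]
      simp [mul_assoc]
  rcases Nat.eq_zero_or_pos γ.length with hr | hr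
  · have e : Fin.last γ.length = 0 := by ext; simp [hr]
    unfold headProduct
    rw [e, Fin.partialProd_zero, Fin.partialProd_zero]
  · obtain ⟨m, hm⟩ : ∃ m, γ.length = m + 1 := ⟨γ.length - 1, by omega⟩
    have hm' : m < γ.length := by omega
    have e : Fin.last γ.length = Fin.succ ⟨m, hm'⟩ := by ext; simp [hm]
    have hq : (q (Fin.castSucc ⟨m, hm'⟩) : SL(n, 𝒦)) ∈ parahoric (vertex γ γ.length) := by
      have hmem := (q (Fin.castSucc ⟨m, hm'⟩)).2
      simp only [segmentGroup, Fin.val_castSucc, if_pos hm'] at hmem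
      have e' : vertex γ γ.length = vertex γ (m + 1) := congrArg (vertex γ) hm
      rw [e']
      exact hmem.2
    have key : headProduct p' = headProduct p * (q (Fin.castSucc ⟨m, hm'⟩) : SL(n, 𝒦)) := by
      unfold headProduct
      rw [e]
      exact step m hm'
    have hfix := loopAct_coweightPoint _ _ hq
    rw [key]
    unfold loopAct at hfix ⊢
    rw [map_mul, mul_smul, hfix]

/-- The canonical map `π : Σ → G'(𝒦) / G'(𝒪)`, `[p_0, …, p_r] ↦ p_0 ⋯ p_{r-1} . μ_r`, the
desingularization of a Schubert variety. -/
def desingularization {n : ℕ} (γ : Gallery n) : BottSamelson γ → AffineGrassmannian n :=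
  Quotient.lift (fun p => loopAct (headProduct p) (coweightPoint (vertex γ γ.length)))
    (fun p p' hp => loopAct_headProduct p p' hp)

/-! ### The torus action and the cells -/

/-- A generic anti-dominant one parameter subgroup `s ↦ diag(s^{a_1}, …, s^{a_n})` of the diagonal
torus of `SL_n(ℂ)`: the exponents have sum `0` and `(α, a) < 0` for all positive roots
`α = ε_i - ε_j`, `i < j`. -/
structure AntidominantCocharacter (n : ℕ) where
  exponent : Fin n → ℤ
  sum_eq_zero : ∑ i, exponent i = 0
  antidominant : ∀ i j, i < j → exponent i - exponent j < 0

theorem prod_zpow_eq {n : ℕ} (a : Fin n → ℤ) (s : ℂˣ) : ∏ i, s ^ a i = s ^ ∑ i, a i := by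
  have h := map_sum (AddMonoidHom.mk' (fun k : ℤ => Additive.ofMul (s ^ k))
    fun x y => by rw [_root_.zpow_add]; rfl) a Finset.univ
  exact h.symm

/-- The element `η(s)`, as a constant loop. -/
def AntidominantCocharacter.eval {n : ℕ} (η : AntidominantCocharacter n) (s : ℂˣ) : SL(n, 𝒦) :=
  ⟨Matrix.diagonal fun a => HahnSeries.C ((s ^ η.exponent a : ℂˣ) : ℂ), by
    rw [Matrix.det_diagonal, ← map_prod, ← Units.coe_prod, prod_zpow_eq, η.sum_eq_zero, zpow_zero, Units.val_one, map_one]⟩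

theorem AntidominantCocharacter.eval_mem {n : ℕ} (η : AntidominantCocharacter n) (s : ℂˣ)
    (μ : Fin n → ℤ) : η.eval s ∈ parahoric μ := by
  intro a b k hk
  change (Matrix.diagonal (fun a => HahnSeries.C ((s ^ η.exponent a : ℂˣ) : ℂ)) a b).coeff k = 0
  by_cases hab : a = b
  · subst hab
    have hk0 : k ≠ 0 := by omega
    rw [Matrix.diagonal_apply_eq, HahnSeries.C_apply, HahnSeries.coeff_single_of_ne hk0]
  · simp [Matrix.diagonal_apply_ne _ hab]

/-- The action of `η(s)` on `𝒫_{μ_0} × ⋯ × 𝒫_{μ_r}`, by left multiplication on the first factor. -/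
def torusActProduct {n : ℕ} (η : AntidominantCocharacter n) (s : ℂˣ) {γ : Gallery n}
    (p : ParahoricProduct γ) : ParahoricProduct γ :=
  Function.update p 0 (⟨η.eval s, η.eval_mem s _⟩ * p 0)

/-- The action of `η(s)` on the Bott-Samelson variety:
`η(s) . [p_0, p_1, …, p_r] = [η(s) p_0, p_1, …, p_r]`. -/
def torusAct {n : ℕ} (η : AntidominantCocharacter n) (s : ℂˣ) {γ : Gallery n} :
    BottSamelson γ → BottSamelson γ :=
  Quotient.map' (s₁ := bottSamelsonSetoid γ) (s₂ := bottSamelsonSetoid γ) (torusActProduct η s) (by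
    rintro p p' ⟨q, h0, h⟩
    refine ⟨q, ?_, fun j => ?_⟩
    · have e : ∀ x : ParahoricProduct γ,
          torusActProduct η s x 0 = ⟨η.eval s, η.eval_mem s _⟩ * x 0 :=
        fun x => Function.update_self _ _ _
      rw [e, e, Subgroup.coe_mul, Subgroup.coe_mul, h0, mul_assoc]
    · have e : ∀ x : ParahoricProduct γ, torusActProduct η s x j.succ = x j.succ :=
        fun x => Function.update_of_ne (Fin.succ_ne_zero j) _ _
      rw [e, e]
      exact h j)

/-- The fixed point `[1, …, 1]` of the Bott-Samelson variety with center `γ`; it is the torus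
fixed point that corresponds to the gallery `γ`. -/
def galleryPoint {n : ℕ} (γ : Gallery n) : BottSamelson γ := BottSamelson.mk fun _ => 1

/-- The cell `C_γ = {x ∈ Σ | lim_{s → 0} η(s) . x = γ}`. -/
def cell {n : ℕ} (η : AntidominantCocharacter n) (γ : Gallery n) : Set (BottSamelson γ) :=
  {x | Tendsto (fun s : ℂˣ => torusAct η s x) (comap (fun s : ℂˣ => (s : ℂ)) (𝓝 0))
    (𝓝 (galleryPoint γ))}

/-- The image `Z_γ = π(C_γ)` of the cell in the affine Grassmannian. -/
def cellImage {n : ℕ} (η : AntidominantCocharacter n) (γ : Gallery n) :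
    Set (AffineGrassmannian n) :=
  desingularization γ '' cell η γ

end LoopGallery

end

/-!
Successively splitting off the big cell of `𝒫_{μ_j}` with respect to `𝒬_j` moves a point of `Σ`
near `[1, …, 1]` to a representative whose components `c_j`, for `j < r`, lie in unipotent groups
opposite to `𝒬_j`; these components are coordinates on an open neighbourhood.  In them `η(s)` acts
by conjugation and multiplies the entry in position `(a, b)` by `s ^ (a_a - a_b)`, so a point of `Σ`
converges to `[1, …, 1]` exactly if it lies in the chart and its coordinates are lower
unitriangular.  Writing `U_μ` for the group of lower unitriangular elements of `𝒫_μ`, it follows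
that `Z_γ` is the orbit of `μ_r` under the set of products `U_{μ_0} U_{μ_1} ⋯ U_{μ_r}`.

If `κ = μ + ε_i` and `ν - κ` only involves letters larger than `i`, then clearing the `i`-th row of
an element of `U_κ` shows `U_κ ⊆ U_μ U_ν`.  Hence breaking up the columns of `γ` into single letters
inserts new factors that do not change the product, and the product depends only on the word.
-/

noncomputable section

namespace LoopGallery

open Filter Topology
open scoped MatrixGroups

/-! ### Block unipotent matrices and slopes -/

section Slope

open Matrix

variable {m R : Type*} [Fintype m] [DecidableEq m] [CommRing R] (p : m → Prop) [DecidablePred p]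

/-- The block unipotent matrix `[[1, 0], [X, 1]]`, where the rows and columns satisfying `p` come
first.  These matrices parametrize the big cell of the Grassmannian of submodules of `m → R`
modelled on the coordinate submodule of `p`. -/
def lowerUnipotent (X : Matrix {a // ¬p a} {a // p a} R) : SpecialLinearGroup m R :=
  ⟨reindex (Equiv.sumCompl p) (Equiv.sumCompl p) (fromBlocks 1 0 X 1), by
    rw [det_reindex_self, det_fromBlocks_zero₁₂, det_one, det_one, one_mul]⟩

theorem lowerUnipotent_apply (X : Matrix {a // ¬p a} {a // p a} R) (a b : m) :
    lowerUnipotent p X a b =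
      if h : ¬p a ∧ p b then X ⟨a, h.1⟩ ⟨b, h.2⟩ else (1 : Matrix m m R) a b := by
  change fromBlocks 1 0 X 1 ((Equiv.sumCompl p).symm a) ((Equiv.sumCompl p).symm b) = _
  by_cases ha : p a <;> by_cases hb : p b
  · simp [ha, hb, one_apply]
  · have hab : a ≠ b := fun e => hb (e ▸ ha)
    simp [ha, hb, hab]
  · simp [ha, hb]
  · simp [ha, hb, one_apply]

theorem toBlock_lowerUnipotent (X : Matrix {a // ¬p a} {a // p a} R) :
    (lowerUnipotent p X : Matrix m m R).toBlock (¬p ·) p = X := by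
  ext a b
  rw [toBlock_apply, lowerUnipotent_apply, dif_pos ⟨a.2, b.2⟩]

theorem toBlock_lowerUnipotent_pos (X : Matrix {a // ¬p a} {a // p a} R) :
    (lowerUnipotent p X : Matrix m m R).toBlock p p = 1 := by
  rw [← toBlock_one_self p]
  ext a b
  rw [toBlock_apply, lowerUnipotent_apply, dif_neg fun h => h.1 a.2, toBlock_apply]

theorem toBlock_lowerUnipotent_neg (X : Matrix {a // ¬p a} {a // p a} R) :
    (lowerUnipotent p X : Matrix m m R).toBlock (¬p ·) (¬p ·) = 1 := by
  rw [← toBlock_one_self (¬p ·)]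
  ext a b
  rw [toBlock_apply, lowerUnipotent_apply, dif_neg fun h => b.2 h.2, toBlock_apply]

theorem lowerUnipotent_zero : lowerUnipotent p (0 : Matrix {a // ¬p a} {a // p a} R) = 1 :=
  Subtype.ext (by simp [lowerUnipotent])

theorem lowerUnipotent_inv (X : Matrix {a // ¬p a} {a // p a} R) :
    (lowerUnipotent p X)⁻¹ = lowerUnipotent p (-X) := by
  have hmul : fromBlocks 1 0 X 1 * fromBlocks 1 0 (-X) 1 =
      (1 : Matrix ({a // p a} ⊕ {a // ¬p a}) ({a // p a} ⊕ {a // ¬p a}) R) := by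
    simp [fromBlocks_multiply]
  refine inv_eq_of_mul_eq_one_right (Subtype.ext ?_)
  change reindex _ _ (fromBlocks 1 0 X 1) * reindex _ _ (fromBlocks 1 0 (-X) 1) = 1
  rw [reindex_apply, reindex_apply, submatrix_mul_equiv, hmul, submatrix_one_equiv]

theorem toBlock_mul_lowerUnipotent_neg_toBlock {H : Matrix m m R}
    (hH : H.toBlock (¬p ·) (¬p ·) = 1) :
    (H * (lowerUnipotent p (-H.toBlock (¬p ·) p) : Matrix m m R)).toBlock (¬p ·) p = 0 := by
  rw [toBlock_mul_eq_add _ p, toBlock_lowerUnipotent_pos, toBlock_lowerUnipotent, hH,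
    Matrix.mul_one, Matrix.one_mul, add_neg_cancel]

/-- The slope `H₂₁ H₁₁⁻¹` of a block matrix `H`.  It is the coordinate, in the big cell of the
Grassmannian, of the submodule spanned by the columns of `H` satisfying `p`; it is meaningful only
if `H₁₁` is invertible, since the inverse of a singular matrix is `0`. -/
def slope (H : Matrix m m R) : Matrix {a // ¬p a} {a // p a} R :=
  H.toBlock (¬p ·) p * (H.toBlock p p)⁻¹

variable {p}

omit [DecidableEq m] in
theorem toBlock_mul_of_toBlock_eq_zero {K : Matrix m m R} (hK : K.toBlock (¬p ·) p = 0)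
    (H : Matrix m m R) (q : m → Prop) :
    (H * K).toBlock q p = H.toBlock q p * K.toBlock p p := by
  rw [toBlock_mul_eq_add q p p, hK, Matrix.mul_zero, add_zero]

theorem slope_mul_of_toBlock_eq_zero {K : Matrix m m R} (hK : K.toBlock (¬p ·) p = 0)
    (hu : IsUnit (K.toBlock p p).det) (H : Matrix m m R) : slope p (H * K) = slope p H := by
  rw [slope, toBlock_mul_of_toBlock_eq_zero hK, toBlock_mul_of_toBlock_eq_zero hK,
    Matrix.mul_inv_rev, ← Matrix.mul_assoc, mul_nonsing_inv_cancel_right _ _ hu, slope]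

theorem slope_one : slope p (1 : Matrix m m R) = 0 := by
  have hzero : (1 : Matrix m m R).toBlock (¬p ·) p = 0 :=
    toBlock_one_disjoint (disjoint_compl_left (a := p))
  rw [slope, hzero, Matrix.zero_mul]

theorem toBlock_lowerUnipotent_neg_slope_mul {H : Matrix m m R}
    (hu : IsUnit (H.toBlock p p).det) :
    ((lowerUnipotent p (-slope p H) : Matrix m m R) * H).toBlock (¬p ·) p = 0 := by
  rw [toBlock_mul_eq_add (¬p ·) p p, toBlock_lowerUnipotent, toBlock_lowerUnipotent_neg, slope,
    Matrix.neg_mul, nonsing_inv_mul_cancel_right _ _ hu, Matrix.one_mul, neg_add_cancel]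

theorem toBlock_diagonal_conj (d : m → Rˣ) (H : Matrix m m R) (q r : m → Prop)
    [DecidablePred q] [DecidablePred r] :
    (diagonal (fun a => (d a : R)) * H * diagonal fun a => (((d a)⁻¹ : Rˣ) : R)).toBlock q r =
      (diagonal fun a : {a // q a} => (d a : R)) * H.toBlock q r *
        diagonal fun a : {a // r a} => (((d a)⁻¹ : Rˣ) : R) := by
  ext a b
  simp only [toBlock_apply, mul_diagonal, diagonal_mul]

theorem det_toBlock_diagonal_conj (d : m → Rˣ) (H : Matrix m m R) :
    ((diagonal (fun a => (d a : R)) * H *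
      diagonal fun a => (((d a)⁻¹ : Rˣ) : R)).toBlock p p).det = (H.toBlock p p).det := by
  rw [toBlock_diagonal_conj, det_mul, det_mul, mul_right_comm, ← det_mul, diagonal_mul_diagonal]
  simp

theorem slope_diagonal_conj (d : m → Rˣ) (H : Matrix m m R) :
    slope p (diagonal (fun a => (d a : R)) * H * diagonal fun a => (((d a)⁻¹ : Rˣ) : R)) =
      (diagonal fun a : {a // ¬p a} => (d a : R)) * slope p H *
        diagonal fun a : {a // p a} => (((d a)⁻¹ : Rˣ) : R) := by
  set D : Matrix {a // p a} {a // p a} R := diagonal fun a => (d a : R)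
  set D' : Matrix {a // p a} {a // p a} R := diagonal fun a => (((d a)⁻¹ : Rˣ) : R)
  have hmul : D * D' = 1 := by simp [D, D']
  have hmul' : D' * D = 1 := by simp [D, D']
  have hinv : (D * H.toBlock p p * D')⁻¹ = D * (H.toBlock p p)⁻¹ * D' := by
    rw [Matrix.mul_inv_rev, Matrix.mul_inv_rev, inv_eq_left_inv hmul, inv_eq_right_inv hmul,
      mul_assoc]
  rw [slope, toBlock_diagonal_conj, toBlock_diagonal_conj, hinv, mul_assoc D, Matrix.mul_assoc _ D',
    ← mul_assoc D', hmul', one_mul, slope]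
  simp only [Matrix.mul_assoc]

theorem continuousAt_slope [TopologicalSpace R] [IsTopologicalRing R] {H : Matrix m m R}
    (hH : ContinuousAt Ring.inverse (H.toBlock p p).det) : ContinuousAt (slope p) H := by
  have hblock : ∀ q r : m → Prop, Continuous fun M : Matrix m m R => M.toBlock q r :=
    fun q r => continuous_id.matrix_submatrix _ _
  have hinv : ContinuousAt (fun M : Matrix m m R => (M.toBlock p p)⁻¹) H :=
    ContinuousAt.comp (f := fun M : Matrix m m R => M.toBlock p p) (continuousAt_matrix_inv _ hH)
      (hblock p p).continuousAt
  exact ((continuous_fst.matrix_mul continuous_snd).continuousAt).comp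
    ((hblock (¬p ·) p).continuousAt.prodMk hinv)

end Slope

/-! ### Coefficients and reduction -/

section Reduction

theorem hahnSeries_coeff_mul_eq_sum {R : Type*} [NonUnitalNonAssocSemiring R]
    {f g : HahnSeries ℤ R} {l m : ℤ} (hf : ∀ i < l, f.coeff i = 0) (hg : ∀ i < m, g.coeff i = 0)
    (k : ℤ) : (f * g).coeff k = ∑ i ∈ Finset.Icc l (k - m), f.coeff i * g.coeff (k - i) := by
  have hle : ∀ i, f.coeff i ≠ 0 → l ≤ i := fun i hi => not_lt.1 fun h => hi (hf i h)
  have hle' : ∀ i, g.coeff i ≠ 0 → m ≤ i := fun i hi => not_lt.1 fun h => hi (hg i h)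
  rw [HahnSeries.coeff_mul]
  refine Finset.sum_of_injOn Prod.fst ?_ ?_ ?_ ?_
  · rintro ⟨i, j⟩ hij ⟨i', j'⟩ hij' (rfl : i = i')
    simp only [Finset.mem_coe, Finset.mem_antidiagonal] at hij hij'
    simpa using hij.2.2.trans hij'.2.2.symm
  · rintro ⟨i, j⟩ hij
    simp only [Finset.mem_coe, Finset.mem_antidiagonal, HahnSeries.mem_support] at hij
    have hi := hle i hij.1
    have hj := hle' j hij.2.1
    simp only [Finset.coe_Icc, Set.mem_Icc]
    omega
  · intro i _ hi
    by_contra h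
    refine hi ⟨(i, k - i), ?_, rfl⟩
    simp only [Finset.mem_coe, Finset.mem_antidiagonal, HahnSeries.mem_support]
    exact ⟨left_ne_zero_of_mul h, right_ne_zero_of_mul h, by omega⟩
  · intro x hx
    rw [← (Finset.mem_antidiagonal.1 hx).2.2, add_sub_cancel_left]

variable {n : ℕ} {μ : Fin n → ℤ}

/-- The family of all coefficients of all matrix entries of `g`.  The topologies on the products of
parahoric subgroups are induced by this map. -/
def coefficients (g : SL(n, 𝒦)) (a b : Fin n) (k : ℤ) : ℂ := (g a b).coeff k

theorem coefficients_injective : Function.Injective (coefficients (n := n)) := by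
  intro g h hgh
  ext a b k
  exact congrFun (congrFun (congrFun hgh a) b) k

theorem coefficients_mul {g h : SL(n, 𝒦)} (hg : g ∈ parahoric μ) (hh : h ∈ parahoric μ)
    (a b : Fin n) (k : ℤ) :
    coefficients (g * h) a b k = ∑ c, ∑ i ∈ Finset.Icc (μ c - μ a) (k - (μ b - μ c)),
      coefficients g a c i * coefficients h c b (k - i) := by
  rw [coefficients, Matrix.SpecialLinearGroup.coe_mul, Matrix.mul_apply, HahnSeries.coeff_sum]
  exact Finset.sum_congr rfl fun c _ => hahnSeries_coeff_mul_eq_sum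
    (fun i hi => hg a c i (by omega)) (fun i hi => hh c b i (by omega)) k

theorem continuousOn_coefficients_mul {X : Type*} [TopologicalSpace X] {W : Set X}
    {F G : X → SL(n, 𝒦)} (hF : ∀ x ∈ W, F x ∈ parahoric μ) (hG : ∀ x ∈ W, G x ∈ parahoric μ)
    (cF : ContinuousOn (coefficients ∘ F) W) (cG : ContinuousOn (coefficients ∘ G) W) :
    ContinuousOn (fun x => coefficients (F x * G x)) W := by
  have hentry : ∀ {H : X → SL(n, 𝒦)}, ContinuousOn (coefficients ∘ H) W → ∀ a b k,
      ContinuousOn (fun x => coefficients (H x) a b k) W := fun cH a b k =>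
    continuousOn_pi.1 (continuousOn_pi.1 (continuousOn_pi.1 cH a) b) k
  refine continuousOn_pi.2 fun a => continuousOn_pi.2 fun b => continuousOn_pi.2 fun k => ?_
  refine ContinuousOn.congr ?_ fun x hx => coefficients_mul (hF x hx) (hG x hx) a b k
  exact continuousOn_finsetSum _ fun c _ => continuousOn_finsetSum _ fun i _ =>
    (hentry cF a c i).mul (hentry cG c b (k - i))

/-- The reduction of an element of `𝒫_μ` modulo the pro-unipotent radical, i.e. the value of
`t^μ g t^{-μ}` at `t = 0`. -/
def reduction (μ : Fin n → ℤ) (g : SL(n, 𝒦)) : Matrix (Fin n) (Fin n) ℂ :=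
  Matrix.of fun a b => coefficients g a b (μ b - μ a)

theorem reduction_mul {g h : SL(n, 𝒦)} (hg : g ∈ parahoric μ) (hh : h ∈ parahoric μ) :
    reduction μ (g * h) = reduction μ g * reduction μ h := by
  ext a b
  simp only [reduction, Matrix.of_apply, Matrix.mul_apply, coefficients_mul hg hh,
    sub_sub_sub_cancel_left, sub_sub_sub_cancel_right, Finset.Icc_self, Finset.sum_singleton]

theorem reduction_one (μ : Fin n → ℤ) : reduction μ 1 = 1 := by
  ext a b
  rcases eq_or_ne a b with rfl | h
  · simp [reduction, coefficients]
  · simp [reduction, coefficients, Matrix.one_apply_ne h]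

theorem continuousOn_reduction {X : Type*} [TopologicalSpace X] {W : Set X} {F : X → SL(n, 𝒦)}
    (cF : ContinuousOn (coefficients ∘ F) W) : ContinuousOn (fun x => reduction μ (F x)) W :=
  continuousOn_pi.2 fun a => continuousOn_pi.2 fun b =>
    continuousOn_pi.1 (continuousOn_pi.1 (continuousOn_pi.1 cF a) b) (μ b - μ a)

end Reduction

/-! ### The big cell of a minuscule step -/

section BigCell

variable {n : ℕ} {μ ν : Fin n → ℤ}

/-- Two coweights are the end points of a segment of a gallery of columns if they differ by `0` or
`1` in each coordinate. -/
def IsMinusculeStep (μ ν : Fin n → ℤ) : Prop := ∀ a, ν a = μ a ∨ ν a = μ a + 1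

/-- The coordinates that increase from `μ` to `ν`.  They single out the parabolic subgroup which is
the image of `𝒫_μ ∩ 𝒫_ν` under reduction. -/
abbrev Raised (μ ν : Fin n → ℤ) (a : Fin n) : Prop := μ a < ν a

theorem mem_parahoric_inf_iff (hstep : IsMinusculeStep μ ν) {g : SL(n, 𝒦)} :
    g ∈ parahoric μ ⊓ parahoric ν ↔
      g ∈ parahoric μ ∧ (reduction μ g).toBlock (¬Raised μ ν ·) (Raised μ ν) = 0 := by
  rw [Subgroup.mem_inf]
  refine and_congr_right fun hμ => ⟨fun hν => ?_, fun hred a b k hk => ?_⟩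
  · ext a b
    refine hν a b _ ?_
    have ha := a.2
    have hb := b.2
    have hstep_a := hstep a
    have hstep_b := hstep b
    omega
  · rcases lt_or_ge (μ a - μ b + k) 0 with hneg | hnonneg
    · exact hμ a b k hneg
    have hstep_a := hstep a
    have hstep_b := hstep b
    obtain ⟨ha, hb, rfl⟩ : ¬Raised μ ν a ∧ Raised μ ν b ∧ k = μ b - μ a := by omega
    exact congrFun (congrFun hred ⟨a, ha⟩) ⟨b, hb⟩

theorem lowerUnipotent_mem_parahoric {p : Fin n → Prop} [DecidablePred p]
    {X : Matrix {a // ¬p a} {a // p a} 𝒦}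
    (hX : ∀ (a : {a // ¬p a}) (b : {a // p a}) k, μ a - μ b + k < 0 → (X a b).coeff k = 0) :
    lowerUnipotent p X ∈ parahoric μ := by
  intro a b k hk
  rw [lowerUnipotent_apply]
  split_ifs
  · exact hX _ _ k hk
  · exact (parahoric μ).one_mem a b k hk

theorem reduction_lowerUnipotent {p : Fin n → Prop} [DecidablePred p]
    (X : Matrix {a // ¬p a} {a // p a} 𝒦) :
    reduction μ (lowerUnipotent p X) =
      lowerUnipotent p (Matrix.of fun a b => (X a b).coeff (μ b - μ a)) := by
  have hone := reduction_one μ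
  ext a b
  rw [lowerUnipotent_apply, reduction, Matrix.of_apply, coefficients, lowerUnipotent_apply]
  split_ifs
  · rfl
  · exact congrFun (congrFun hone a) b

/-- The block unipotent matrix of `𝒫_μ` which is homogeneous for the loop rotation fixing `μ` and
has reduction `[[1, 0], [X, 1]]`. -/
def oppositeElement (μ : Fin n → ℤ) (p : Fin n → Prop) [DecidablePred p]
    (X : Matrix {a // ¬p a} {a // p a} ℂ) : SL(n, 𝒦) :=
  lowerUnipotent p (Matrix.of fun a b => HahnSeries.single (μ b - μ a) (X a b))

section OppositeElement

variable (μ) (p : Fin n → Prop) [DecidablePred p] (X : Matrix {a // ¬p a} {a // p a} ℂ)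

theorem coefficients_oppositeElement (a b : Fin n) (k : ℤ) :
    coefficients (oppositeElement μ p X) a b k =
      if h : ¬p a ∧ p b then if k = μ b - μ a then X ⟨a, h.1⟩ ⟨b, h.2⟩ else 0
      else if a = b ∧ k = 0 then 1 else 0 := by
  rw [coefficients, oppositeElement, lowerUnipotent_apply]
  split_ifs with h hk hk
  · rw [Matrix.of_apply, hk, HahnSeries.coeff_single_same]
  · rw [Matrix.of_apply, HahnSeries.coeff_single_of_ne hk]
  · rw [hk.1, hk.2, Matrix.one_apply_eq, HahnSeries.coeff_one, if_pos rfl]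
  · rcases eq_or_ne a b with rfl | hab
    · rw [Matrix.one_apply_eq, HahnSeries.coeff_one, if_neg (by simpa using hk)]
    · rw [Matrix.one_apply_ne hab, HahnSeries.coeff_zero]

theorem oppositeElement_mem : oppositeElement μ p X ∈ parahoric μ :=
  lowerUnipotent_mem_parahoric fun a b k hk => HahnSeries.coeff_single_of_ne (by omega)

theorem reduction_oppositeElement :
    reduction μ (oppositeElement μ p X) = lowerUnipotent p X := by
  simp only [oppositeElement, reduction_lowerUnipotent, Matrix.of_apply,
    HahnSeries.coeff_single_same]
  rfl

omit X in
theorem oppositeElement_zero : oppositeElement μ p 0 = 1 := by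
  have hzero : (Matrix.of fun (a : {a // ¬p a}) (b : {a // p a}) =>
      HahnSeries.single (μ b - μ a) ((0 : Matrix {a // ¬p a} {a // p a} ℂ) a b) :
      Matrix _ _ 𝒦) = 0 := by
    ext a b : 2
    simp
  rw [oppositeElement, hzero, lowerUnipotent_zero]

theorem oppositeElement_inv : (oppositeElement μ p X)⁻¹ = oppositeElement μ p (-X) := by
  rw [oppositeElement, lowerUnipotent_inv, oppositeElement]
  congr 1
  ext a b : 2
  simp

theorem continuous_coefficients_oppositeElement :
    Continuous fun X => coefficients (oppositeElement μ p X) := by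
  refine continuous_pi fun a => continuous_pi fun b => continuous_pi fun k => ?_
  simp only [coefficients_oppositeElement]
  split_ifs
  · fun_prop
  all_goals exact continuous_const

end OppositeElement

/-- The component in the opposite unipotent group of an element of the big cell of `𝒫_μ` with
respect to `𝒫_μ ∩ 𝒫_ν`. -/
def bigCellPart (μ ν : Fin n → ℤ) (g : SL(n, 𝒦)) : SL(n, 𝒦) :=
  oppositeElement μ (Raised μ ν) (slope (Raised μ ν) (reduction μ g))

/-- The big cell of `𝒫_μ` with respect to `𝒫_μ ∩ 𝒫_ν`: the preimage under reduction of the product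
of the opposite unipotent group and the parabolic subgroup. -/
def InBigCell (μ ν : Fin n → ℤ) (g : SL(n, 𝒦)) : Prop :=
  IsUnit ((reduction μ g).toBlock (Raised μ ν) (Raised μ ν)).det

theorem bigCellPart_mem (μ ν : Fin n → ℤ) (g : SL(n, 𝒦)) : bigCellPart μ ν g ∈ parahoric μ :=
  oppositeElement_mem _ _ _

theorem bigCellPart_one (μ ν : Fin n → ℤ) : bigCellPart μ ν 1 = 1 := by
  rw [bigCellPart, reduction_one, slope_one, oppositeElement_zero]

theorem bigCellPart_inv_mul_mem (hstep : IsMinusculeStep μ ν) {g : SL(n, 𝒦)}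
    (hg : g ∈ parahoric μ) (hcell : InBigCell μ ν g) :
    (bigCellPart μ ν g)⁻¹ * g ∈ parahoric μ ⊓ parahoric ν := by
  rw [mem_parahoric_inf_iff hstep, bigCellPart, oppositeElement_inv,
    reduction_mul (oppositeElement_mem _ _ _) hg, reduction_oppositeElement]
  exact ⟨mul_mem (oppositeElement_mem _ _ _) hg, toBlock_lowerUnipotent_neg_slope_mul hcell⟩

theorem inBigCell_of_mem (hstep : IsMinusculeStep μ ν) {q : SL(n, 𝒦)}
    (hq : q ∈ parahoric μ ⊓ parahoric ν) : InBigCell μ ν q := by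
  have hq' := (mem_parahoric_inf_iff hstep).1 hq
  have hinv : (reduction μ q⁻¹).toBlock (Raised μ ν) (Raised μ ν) *
      (reduction μ q).toBlock (Raised μ ν) (Raised μ ν) = 1 := by
    rw [← toBlock_mul_of_toBlock_eq_zero hq'.2, ← reduction_mul (inv_mem hq'.1) hq'.1,
      inv_mul_cancel, reduction_one, Matrix.toBlock_one_self]
  exact Matrix.isUnit_det_of_left_inverse hinv

theorem inBigCell_mul_iff (hstep : IsMinusculeStep μ ν) {g q : SL(n, 𝒦)} (hg : g ∈ parahoric μ)
    (hq : q ∈ parahoric μ ⊓ parahoric ν) : InBigCell μ ν (g * q) ↔ InBigCell μ ν g := by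
  have hq' := (mem_parahoric_inf_iff hstep).1 hq
  rw [InBigCell, reduction_mul hg hq'.1, toBlock_mul_of_toBlock_eq_zero hq'.2, Matrix.det_mul,
    IsUnit.mul_iff]
  exact and_iff_left (inBigCell_of_mem hstep hq)

theorem bigCellPart_mul (hstep : IsMinusculeStep μ ν) {g q : SL(n, 𝒦)} (hg : g ∈ parahoric μ)
    (hq : q ∈ parahoric μ ⊓ parahoric ν) : bigCellPart μ ν (g * q) = bigCellPart μ ν g := by
  have hq' := (mem_parahoric_inf_iff hstep).1 hq
  rw [bigCellPart, reduction_mul hg hq'.1,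
    slope_mul_of_toBlock_eq_zero hq'.2 (inBigCell_of_mem hstep hq), bigCellPart]

section Continuity

variable {X : Type*} [TopologicalSpace X] {W : Set X} {F : X → SL(n, 𝒦)}

theorem continuousOn_slope_reduction (cF : ContinuousOn (coefficients ∘ F) W)
    (hF : ∀ x ∈ W, InBigCell μ ν (F x)) :
    ContinuousOn (fun x => slope (Raised μ ν) (reduction μ (F x))) W := fun x hx =>
  ContinuousAt.comp_continuousWithinAt (f := fun x => reduction μ (F x))
    (continuousAt_slope (NormedRing.inverse_continuousAt (hF x hx).unit))
    (continuousOn_reduction cF x hx)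

theorem continuousOn_coefficients_bigCellPart (cF : ContinuousOn (coefficients ∘ F) W)
    (hF : ∀ x ∈ W, InBigCell μ ν (F x)) :
    ContinuousOn (fun x => coefficients (bigCellPart μ ν (F x))) W :=
  (continuous_coefficients_oppositeElement _ _).comp_continuousOn
    (continuousOn_slope_reduction cF hF)

theorem continuousOn_coefficients_bigCellPart_inv (cF : ContinuousOn (coefficients ∘ F) W)
    (hF : ∀ x ∈ W, InBigCell μ ν (F x)) :
    ContinuousOn (fun x => coefficients (bigCellPart μ ν (F x))⁻¹) W := by
  simp only [bigCellPart, oppositeElement_inv]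
  exact (continuous_coefficients_oppositeElement _ _).comp_continuousOn
    (continuousOn_slope_reduction cF hF).neg

theorem isOpen_setOf_inBigCell (hW : IsOpen W) (cF : ContinuousOn (coefficients ∘ F) W) :
    IsOpen {x | x ∈ W ∧ InBigCell μ ν (F x)} := by
  have hdet : Continuous fun M : Matrix (Fin n) (Fin n) ℂ =>
      (M.toBlock (Raised μ ν) (Raised μ ν)).det :=
    (continuous_id.matrix_submatrix _ _).matrix_det
  exact (hdet.comp_continuousOn (continuousOn_reduction cF)).isOpen_inter_preimage hW Units.isOpen

end Continuity

section TorusConjugation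

variable (η : AntidominantCocharacter n) (s : ℂˣ) (g : SL(n, 𝒦))

theorem coefficients_conj_eval (a b : Fin n) (k : ℤ) :
    coefficients (MulAut.conj (η.eval s) g) a b k =
      ↑(s ^ η.exponent a) * coefficients g a b k * ↑(s ^ η.exponent b)⁻¹ := by
  have hcomm : MulAut.conj (η.eval s) g * η.eval s = η.eval s * g := by
    rw [MulAut.conj_apply, inv_mul_cancel_right]
  have hentry : (MulAut.conj (η.eval s) g) a b * HahnSeries.C ((s ^ η.exponent b : ℂˣ) : ℂ) =
      HahnSeries.C ((s ^ η.exponent a : ℂˣ) : ℂ) * g a b := by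
    have hmat := congrArg (fun h : SL(n, 𝒦) => (h : Matrix (Fin n) (Fin n) 𝒦) a b) hcomm
    have hcoe : (η.eval s : Matrix (Fin n) (Fin n) 𝒦) =
        Matrix.diagonal fun a => HahnSeries.C ((s ^ η.exponent a : ℂˣ) : ℂ) := rfl
    simpa only [Matrix.SpecialLinearGroup.coe_mul, hcoe, Matrix.mul_diagonal,
      Matrix.diagonal_mul] using hmat
  have hcoeff := congrArg (fun f : 𝒦 => f.coeff k) hentry
  rw [Units.eq_mul_inv_iff_mul_eq]
  simpa only [coefficients, HahnSeries.C_apply, HahnSeries.coeff_single_zero_mul,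
    HahnSeries.coeff_mul_single_zero] using hcoeff

theorem reduction_conj_eval :
    reduction μ (MulAut.conj (η.eval s) g) =
      Matrix.diagonal (fun a => ((s ^ η.exponent a : ℂˣ) : ℂ)) * reduction μ g *
        Matrix.diagonal fun a => (((s ^ η.exponent a)⁻¹ : ℂˣ) : ℂ) := by
  ext a b
  rw [Matrix.mul_diagonal, Matrix.diagonal_mul, reduction, Matrix.of_apply,
    coefficients_conj_eval, reduction, Matrix.of_apply]

theorem inBigCell_conj_eval_iff :
    InBigCell μ ν (MulAut.conj (η.eval s) g) ↔ InBigCell μ ν g := by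
  rw [InBigCell, reduction_conj_eval, det_toBlock_diagonal_conj, InBigCell]

theorem bigCellPart_conj_eval :
    bigCellPart μ ν (MulAut.conj (η.eval s) g) = MulAut.conj (η.eval s) (bigCellPart μ ν g) := by
  apply coefficients_injective
  ext a b k
  rw [coefficients_conj_eval, bigCellPart, bigCellPart, coefficients_oppositeElement,
    coefficients_oppositeElement, reduction_conj_eval, slope_diagonal_conj]
  split_ifs with h hk hk
  · rw [Matrix.mul_diagonal, Matrix.diagonal_mul]
  · rw [mul_zero, zero_mul]
  · rw [hk.1, mul_one, Units.mul_inv]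
  · rw [mul_zero, zero_mul]

end TorusConjugation

end BigCell

/-! ### Lower unitriangular elements of parahoric subgroups -/

section LowerUnitriangular

variable {m R : Type*} [Fintype m] [LinearOrder m] [CommRing R]

/-- The lower unitriangular matrices of determinant one, i.e. the maximal unipotent subgroup
contracted by an antidominant one parameter subgroup. -/
def lowerUnitriangular (m R : Type*) [Fintype m] [LinearOrder m] [CommRing R] :
    Submonoid (Matrix.SpecialLinearGroup m R) where
  carrier := {g | ∀ a b, a ≤ b → g a b = (1 : Matrix m m R) a b}
  one_mem' := fun _ _ _ => rfl
  mul_mem' := by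
    intro g h hg hh a b hab
    have hentry : ∀ c, g a c * h c b = (1 : Matrix m m R) a c * (1 : Matrix m m R) c b := by
      intro c
      rcases lt_trichotomy c a with hca | rfl | hac
      · rw [hh c b (hca.le.trans hab), Matrix.one_apply_ne (hca.trans_le hab).ne, mul_zero,
          mul_zero]
      · rw [hg c c le_rfl, hh c b hab]
      · rw [hg a c hac.le, Matrix.one_apply_ne hac.ne, zero_mul, zero_mul]
    rw [Matrix.SpecialLinearGroup.coe_mul, Matrix.mul_apply,
      Finset.sum_congr rfl fun c _ => hentry c, ← Matrix.mul_apply, mul_one]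

theorem mem_lowerUnitriangular {g : Matrix.SpecialLinearGroup m R} :
    g ∈ lowerUnitriangular m R ↔ ∀ a b, a ≤ b → g a b = (1 : Matrix m m R) a b :=
  Iff.rfl

theorem lowerUnipotent_mem_lowerUnitriangular {p : m → Prop} [DecidablePred p]
    {X : Matrix {a // ¬p a} {a // p a} R}
    (hX : ∀ (a : {a // ¬p a}) (b : {a // p a}), (a : m) ≤ b → X a b = 0) :
    lowerUnipotent p X ∈ lowerUnitriangular m R := by
  rw [mem_lowerUnitriangular]
  intro a b hab
  rw [lowerUnipotent_apply]
  split_ifs with hp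
  · have hne : a ≠ b := fun e => hp.1 (e ▸ hp.2)
    rw [hX ⟨a, hp.1⟩ ⟨b, hp.2⟩ hab, Matrix.one_apply_ne hne]
  · rfl

end LowerUnitriangular

section PathProduct

open scoped Pointwise

variable {n : ℕ} {μ ν κ : Fin n → ℤ}

/-- The lower unitriangular elements of the parahoric subgroup `𝒫_μ`. -/
def lowerParahoric (μ : Fin n → ℤ) : Submonoid SL(n, 𝒦) :=
  lowerUnitriangular (Fin n) 𝒦 ⊓ (parahoric μ).toSubmonoid

/-- The set of products of lower unitriangular elements of the parahoric subgroups at the successive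
vertices of the polyline with the given starting point and steps. -/
def pathProduct (μ : Fin n → ℤ) : List (Fin n → ℤ) → Set SL(n, 𝒦)
  | [] => lowerParahoric μ
  | v :: vs => (lowerParahoric μ : Set SL(n, 𝒦)) * pathProduct (μ + v) vs

theorem lowerParahoric_mul_pathProduct (μ : Fin n → ℤ) (vs : List (Fin n → ℤ)) :
    (lowerParahoric μ : Set SL(n, 𝒦)) * pathProduct μ vs = pathProduct μ vs := by
  cases vs with
  | nil => exact Submonoid.coe_mul_self_eq _
  | cons v vs => rw [pathProduct, ← mul_assoc, Submonoid.coe_mul_self_eq]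

theorem mem_pathProduct_iff {vs : List (Fin n → ℤ)} {g : SL(n, 𝒦)} :
    g ∈ pathProduct μ vs ↔ ∃ u : ℕ → SL(n, 𝒦),
      (∀ j, u j ∈ lowerParahoric (μ + (vs.take j).sum)) ∧
        g = ((List.range (vs.length + 1)).map u).prod := by
  induction vs generalizing μ g with
  | nil =>
    simp only [pathProduct, List.take_nil, List.sum_nil, add_zero, List.length_nil, zero_add,
      List.range_one, List.map_singleton, List.prod_singleton]
    exact ⟨fun hg => ⟨fun _ => g, fun _ => hg, rfl⟩, fun ⟨_, hu, hg⟩ => hg ▸ hu 0⟩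
  | cons v vs ih =>
    rw [pathProduct, Set.mem_mul]
    constructor
    · rintro ⟨x, hx, y, hy, rfl⟩
      obtain ⟨u, hu, rfl⟩ := ih.1 hy
      refine ⟨fun | 0 => x | j + 1 => u j, ?_, ?_⟩
      · rintro (_ | j)
        · simpa using hx
        · simpa [add_assoc] using hu j
      · rw [List.length_cons, List.prod_range_succ' _ (vs.length + 1)]
    · rintro ⟨u, hu, rfl⟩
      refine ⟨u 0, by simpa using hu 0, _, ih.2 ⟨fun j => u (j + 1), fun j => ?_, rfl⟩, ?_⟩
      · simpa [add_assoc] using hu (j + 1)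
      · rw [List.length_cons, List.prod_range_succ' _ (vs.length + 1)]

theorem mem_parahoric_of_row_eq_zero {i : Fin n} {x : SL(n, 𝒦)}
    (hx : x ∈ parahoric (μ + Pi.single i 1)) (hrow : ∀ b, b ≠ i → x i b = 0) :
    x ∈ parahoric μ := by
  intro a b k hk
  rcases eq_or_ne a i with rfl | ha
  · rcases eq_or_ne b a with rfl | hb
    · exact hx b b k (by simpa using hk)
    · rw [hrow b hb, HahnSeries.coeff_zero]
  · refine hx a b k ?_
    have hb : (0 : Fin n → ℤ) b ≤ Pi.single (M := fun _ => ℤ) i 1 b :=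
      Pi.single_nonneg.2 zero_le_one b
    rw [Pi.zero_apply] at hb
    simp only [Pi.add_apply, Pi.single_eq_of_ne ha]
    omega

/-- Clearing the `i`-th row of `g` leaves an element that stays integral when the `i`-th coordinate
drops by one. -/
theorem lowerParahoric_subset_mul {i : Fin n} (hκ : κ = μ + Pi.single i 1)
    (hν : ∀ a ≤ i, ν a = κ a) :
    (lowerParahoric κ : Set SL(n, 𝒦)) ⊆ lowerParahoric μ * lowerParahoric ν := by
  intro g hg
  have hunit := mem_lowerUnitriangular.1 hg.1
  set row := (g : Matrix (Fin n) (Fin n) 𝒦).toBlock (¬· ≠ i) (· ≠ i)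
  have hrow : ∀ (a : {a // ¬a ≠ i}) (b : {b // b ≠ i}), (a : Fin n) ≤ b → row a b = 0 :=
    fun a b hab => (hunit a b hab).trans (Matrix.one_apply_ne fun e => a.2 (e ▸ b.2))
  have hrow_ν : ∀ (a : {a // ¬a ≠ i}) (b : {b // b ≠ i}) k, ν a - ν b + k < 0 →
      (row a b).coeff k = 0 := by
    intro a b k hk
    rcases le_total (a : Fin n) b with hab | hba
    · rw [hrow a b hab, HahnSeries.coeff_zero]
    · have ha : (a : Fin n) = i := not_not.1 a.2
      exact hg.2 a b k (by rwa [← hν a ha.le, ← hν b (hba.trans ha.le)])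
  have hcorner : (g : Matrix (Fin n) (Fin n) 𝒦).toBlock (¬· ≠ i) (¬· ≠ i) = 1 := by
    rw [← Matrix.toBlock_one_self]
    ext a b : 1
    exact hunit a b ((not_not.1 a.2).trans (not_not.1 b.2).symm).le
  set x := g * lowerUnipotent (· ≠ i) (-row)
  have hx_lower : x ∈ lowerUnitriangular (Fin n) 𝒦 :=
    mul_mem hg.1 (lowerUnipotent_mem_lowerUnitriangular fun a b hab => by
      rw [Matrix.neg_apply, hrow a b hab, neg_zero])
  have hx_κ : x ∈ parahoric κ := mul_mem hg.2 (lowerUnipotent_mem_parahoric fun a b k hk => by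
    rw [Matrix.neg_apply, HahnSeries.coeff_neg]
    exact (congrArg Neg.neg (hg.2 a b k hk)).trans neg_zero)
  have hx_row : ∀ b, b ≠ i → x i b = 0 := fun b hb =>
    congrFun (congrFun (toBlock_mul_lowerUnipotent_neg_toBlock _ hcorner) ⟨i, not_not.2 rfl⟩)
      ⟨b, hb⟩
  refine ⟨x, ⟨hx_lower, mem_parahoric_of_row_eq_zero (hκ ▸ hx_κ) hx_row⟩,
    lowerUnipotent (· ≠ i) row,
    ⟨lowerUnipotent_mem_lowerUnitriangular hrow, lowerUnipotent_mem_parahoric hrow_ν⟩, ?_⟩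
  simp only [x, ← lowerUnipotent_inv, inv_mul_cancel_right]

theorem lowerParahoric_mul_mul {i : Fin n} (hκ : κ = μ + Pi.single i 1)
    (hν : ∀ a ≤ i, ν a = κ a) :
    (lowerParahoric μ * (lowerParahoric κ * lowerParahoric ν) : Set SL(n, 𝒦)) =
      lowerParahoric μ * lowerParahoric ν := by
  apply subset_antisymm
  · calc (lowerParahoric μ * (lowerParahoric κ * lowerParahoric ν) : Set SL(n, 𝒦))
        ⊆ lowerParahoric μ * ((lowerParahoric μ * lowerParahoric ν) * lowerParahoric ν) := by
          gcongr
          exact lowerParahoric_subset_mul hκ hν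
      _ = lowerParahoric μ * lowerParahoric ν := by
          rw [mul_assoc, Submonoid.coe_mul_self_eq, ← mul_assoc, Submonoid.coe_mul_self_eq]
  · gcongr
    exact Set.subset_mul_right _ (one_mem (lowerParahoric κ))

theorem sum_map_single_apply (v : List (Fin n)) (a : Fin n) :
    ((v.map (Pi.single · 1)).sum : Fin n → ℤ) a = v.count a := by
  induction v with
  | nil => rfl
  | cons i v ih =>
    rw [List.map_cons, List.sum_cons, Pi.add_apply, ih, List.count_cons, Nat.cast_add, add_comm,
      Pi.single_apply]
    rcases eq_or_ne a i with rfl | hai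
    · simp
    · simp [hai, hai.symm]

theorem pathProduct_append {v : List (Fin n)} (hv : v.Pairwise (· < ·)) (μ : Fin n → ℤ)
    (vs : List (Fin n → ℤ)) :
    pathProduct μ (v.map (Pi.single · 1) ++ vs) =
      pathProduct μ ((v.map (Pi.single · 1)).sum :: vs) := by
  induction v generalizing μ with
  | nil => simp [pathProduct, lowerParahoric_mul_pathProduct]
  | cons i v ih =>
    obtain ⟨hi, hv⟩ := List.pairwise_cons.1 hv
    set κ := μ + Pi.single i 1
    set ν := κ + (v.map (Pi.single · 1)).sum
    have hν : ∀ a ≤ i, ν a = κ a := by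
      intro a ha
      have hnotMem : a ∉ v := fun hav => (hi a hav).not_ge ha
      simp [ν, sum_map_single_apply, List.count_eq_zero.2 hnotMem]
    calc pathProduct μ ((i :: v).map (Pi.single · 1) ++ vs)
        = lowerParahoric μ * pathProduct κ (v.map (Pi.single · 1) ++ vs) := rfl
      _ = lowerParahoric μ * (lowerParahoric κ * (lowerParahoric ν * pathProduct ν vs)) := by
          rw [ih hv, pathProduct, lowerParahoric_mul_pathProduct]
      _ = lowerParahoric μ * pathProduct ν vs := by
          rw [← mul_assoc (lowerParahoric κ : Set SL(n, 𝒦)), ← mul_assoc,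
            lowerParahoric_mul_mul rfl hν, mul_assoc, lowerParahoric_mul_pathProduct]
      _ = pathProduct μ (((i :: v).map (Pi.single · 1)).sum :: vs) := by
          rw [pathProduct, List.map_cons, List.sum_cons, ← add_assoc]

theorem columnCoweight_eq_sum (c : Column n) :
    columnCoweight c = (c.1.map (Pi.single · 1)).sum := by
  have hnodup : c.1.Nodup := c.2.2.imp ne_of_lt
  ext a
  rw [sum_map_single_apply, hnodup.count, columnCoweight]
  split_ifs <;> rfl

theorem pathProduct_columnCoweight (μ : Fin n → ℤ) (γ : Gallery n) :
    pathProduct μ (γ.map columnCoweight) = pathProduct μ (γ.word.map (Pi.single · 1)) := by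
  induction γ generalizing μ with
  | nil => rfl
  | cons c γ ih =>
    have hword : Gallery.word (c :: γ) = c.1 ++ Gallery.word γ := rfl
    rw [hword, List.map_append, pathProduct_append c.2.2, List.map_cons, pathProduct, pathProduct,
      ih, columnCoweight_eq_sum]

theorem vertex_length (γ : Gallery n) :
    vertex γ γ.length = (γ.word.map (Pi.single · 1)).sum := by
  rw [vertex, List.take_length]
  induction γ with
  | nil => rfl
  | cons c γ ih =>
    have hword : Gallery.word (c :: γ) = c.1 ++ Gallery.word γ := rfl
    rw [hword, List.map_append, List.sum_append, List.map_cons, List.sum_cons, ih,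
      columnCoweight_eq_sum]

end PathProduct

/-! ### The chart of a Bott-Samelson variety around its base point -/

section Chart

variable {n : ℕ} {μ : ℕ → Fin n → ℤ} {P P' q : ℕ → SL(n, 𝒦)}

/-- The last component of a representative of `[p₀, …, p_j]` whose earlier components lie in the
opposite unipotent groups.  Each step splits off the big cell part of the current component and
moves the remaining factor to the next component. -/
def straighten (μ : ℕ → Fin n → ℤ) (P : ℕ → SL(n, 𝒦)) : ℕ → SL(n, 𝒦)
  | 0 => P 0
  | j + 1 => (bigCellPart (μ j) (μ (j + 1)) (straighten μ P j))⁻¹ * straighten μ P j * P (j + 1)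

/-- The coordinates of `[p₀, p₁, …]` in the product of the opposite unipotent groups. -/
def chart (μ : ℕ → Fin n → ℤ) (P : ℕ → SL(n, 𝒦)) (j : ℕ) : SL(n, 𝒦) :=
  bigCellPart (μ j) (μ (j + 1)) (straighten μ P j)

/-- The first `m` coordinates of `[p₀, p₁, …]` are meaningful: all the elements that are split lie
in the big cells. -/
def InChart (μ : ℕ → Fin n → ℤ) (P : ℕ → SL(n, 𝒦)) (m : ℕ) : Prop :=
  ∀ j < m, InBigCell (μ j) (μ (j + 1)) (straighten μ P j)

theorem inChart_succ_iff {m : ℕ} :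
    InChart μ P (m + 1) ↔ InChart μ P m ∧ InBigCell (μ m) (μ (m + 1)) (straighten μ P m) :=
  Nat.forall_lt_succ_right

theorem chart_mem (μ : ℕ → Fin n → ℤ) (P : ℕ → SL(n, 𝒦)) (j : ℕ) : chart μ P j ∈ parahoric (μ j) :=
  bigCellPart_mem _ _ _

theorem prod_eq_prod_chart_mul_straighten (μ : ℕ → Fin n → ℤ) (P : ℕ → SL(n, 𝒦)) (m : ℕ) :
    ((List.range (m + 1)).map P).prod =
      ((List.range m).map (chart μ P)).prod * straighten μ P m := by
  induction m with
  | zero => simp [straighten]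
  | succ m ih =>
    rw [List.prod_range_succ, ih, List.prod_range_succ _ m, straighten, chart]
    group

theorem straighten_one (μ : ℕ → Fin n → ℤ) (m : ℕ) : straighten μ 1 m = 1 := by
  induction m with
  | zero => rfl
  | succ m ih => simp [straighten, ih, bigCellPart_one]

theorem chart_one (μ : ℕ → Fin n → ℤ) (j : ℕ) : chart μ 1 j = 1 := by
  rw [chart, straighten_one, bigCellPart_one]

section TorusConjugation

variable (η : AntidominantCocharacter n) (s : ℂˣ)

theorem straighten_conj_eval (m : ℕ) :
    straighten μ (MulAut.conj (η.eval s) ∘ P) m = MulAut.conj (η.eval s) (straighten μ P m) := by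
  induction m with
  | zero => rfl
  | succ m ih =>
    rw [straighten, ih, bigCellPart_conj_eval, straighten, map_mul, map_mul, map_inv,
      Function.comp_apply]

theorem chart_conj_eval (j : ℕ) :
    chart μ (MulAut.conj (η.eval s) ∘ P) j = MulAut.conj (η.eval s) (chart μ P j) := by
  rw [chart, straighten_conj_eval, bigCellPart_conj_eval, chart]

theorem inChart_conj_eval_iff {m : ℕ} :
    InChart μ (MulAut.conj (η.eval s) ∘ P) m ↔ InChart μ P m := by
  simp only [InChart, straighten_conj_eval, inBigCell_conj_eval_iff]

end TorusConjugation

section Minuscule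

variable (hstep : ∀ j, IsMinusculeStep (μ j) (μ (j + 1)))
include hstep

theorem inChart_one (m : ℕ) : InChart μ 1 m := fun j _ => by
  rw [straighten_one]
  exact inBigCell_of_mem (hstep j) (one_mem _)

theorem straighten_mem (hP : ∀ j, P j ∈ parahoric (μ j)) {m : ℕ} (hchart : InChart μ P m) :
    straighten μ P m ∈ parahoric (μ m) := by
  induction m with
  | zero => exact hP 0
  | succ m ih =>
    obtain ⟨hchart, hcell⟩ := inChart_succ_iff.1 hchart
    exact mul_mem (bigCellPart_inv_mul_mem (hstep m) (ih hchart) hcell).2 (hP (m + 1))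

section Equivalence

variable {r : ℕ} (hP : ∀ j, P j ∈ parahoric (μ j))
  (hq : ∀ j, q j ∈ parahoric (μ j) ⊓ parahoric (μ (j + 1))) (hzero : P' 0 = P 0 * q 0)
  (hsucc : ∀ j < r, P' (j + 1) = (q j)⁻¹ * P (j + 1) * q (j + 1))
include hP hq hzero hsucc

theorem straighten_eq_mul {m : ℕ} (hm : m ≤ r) (hchart : InChart μ P m) :
    straighten μ P' m = straighten μ P m * q m := by
  induction m with
  | zero => exact hzero
  | succ m ih =>
    obtain ⟨hchart, -⟩ := inChart_succ_iff.1 hchart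
    rw [straighten, ih (by omega) hchart,
      bigCellPart_mul (hstep m) (straighten_mem hstep hP hchart) (hq m), hsucc m hm, straighten]
    group

theorem inChart_of_equivalent (hchart : InChart μ P r) : InChart μ P' r := fun j hj => by
  have hchart_j : InChart μ P j := fun i hi => hchart i (hi.trans hj)
  rw [straighten_eq_mul hstep hP hq hzero hsucc hj.le hchart_j,
    inBigCell_mul_iff (hstep j) (straighten_mem hstep hP hchart_j) (hq j)]
  exact hchart j hj

theorem chart_eq_of_equivalent (hchart : InChart μ P r) {j : ℕ} (hj : j < r) :
    chart μ P' j = chart μ P j := by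
  have hchart_j : InChart μ P j := fun i hi => hchart i (hi.trans hj)
  rw [chart, straighten_eq_mul hstep hP hq hzero hsucc hj.le hchart_j,
    bigCellPart_mul (hstep j) (straighten_mem hstep hP hchart_j) (hq j), chart]

end Equivalence

section Continuity

variable {X : Type*} [TopologicalSpace X] {F : X → ℕ → SL(n, 𝒦)}
  (hF : ∀ x j, F x j ∈ parahoric (μ j)) (cF : ∀ j, Continuous fun x => coefficients (F x j))
include hF cF

theorem isOpen_setOf_inChart_and_continuousOn_straighten (m : ℕ) :
    IsOpen {x | InChart μ (F x) m} ∧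
      ContinuousOn (fun x => coefficients (straighten μ (F x) m)) {x | InChart μ (F x) m} := by
  induction m with
  | zero => exact ⟨by simp [InChart], (cF 0).continuousOn⟩
  | succ m ih =>
    obtain ⟨hopen, hcont⟩ := ih
    simp only [inChart_succ_iff]
    refine ⟨isOpen_setOf_inBigCell hopen hcont, ?_⟩
    have hcont : ContinuousOn (fun x => coefficients (straighten μ (F x) m))
        {x | InChart μ (F x) m ∧ InBigCell (μ m) (μ (m + 1)) (straighten μ (F x) m)} :=
      hcont.mono fun x hx => hx.1
    refine continuousOn_coefficients_mul (fun x hx => ?_) (fun x _ => hF x (m + 1)) ?_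
      (cF (m + 1)).continuousOn
    · exact (bigCellPart_inv_mul_mem (hstep m) (straighten_mem hstep (hF x) hx.1) hx.2).2
    · exact continuousOn_coefficients_mul (fun x _ => inv_mem (bigCellPart_mem _ _ _))
        (fun x hx => straighten_mem hstep (hF x) hx.1)
        (continuousOn_coefficients_bigCellPart_inv hcont fun x hx => hx.2) hcont

theorem isOpen_setOf_inChart (m : ℕ) : IsOpen {x | InChart μ (F x) m} :=
  (isOpen_setOf_inChart_and_continuousOn_straighten hstep hF cF m).1

theorem continuousOn_coefficients_chart {r j : ℕ} (hj : j < r) :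
    ContinuousOn (fun x => coefficients (chart μ (F x) j)) {x | InChart μ (F x) r} :=
  continuousOn_coefficients_bigCellPart
    ((isOpen_setOf_inChart_and_continuousOn_straighten hstep hF cF j).2.mono
      fun _ hx i hi => hx i (hi.trans hj))
    fun _ hx => hx j hj

end Continuity

end Minuscule

end Chart

/-! ### Limits in quotient spaces and limits under the one parameter subgroup -/

section Quotient

variable {X Y Z ι : Type*} [TopologicalSpace X] [TopologicalSpace Y] {π : X → Y} {φ : ι → X}
  {l : Filter ι} {x₀ : X} {U : Set X}

theorem eventually_mem_of_tendsto_quotient (hπ : IsQuotientMap π) (hU : IsOpen U)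
    (hsat : ∀ x y, π x = π y → x ∈ U → y ∈ U) (hx₀ : x₀ ∈ U)
    (hφ : Tendsto (π ∘ φ) l (𝓝 (π x₀))) : ∀ᶠ i in l, φ i ∈ U := by
  have himage : π ⁻¹' (π '' U) = U :=
    Set.Subset.antisymm (fun y ⟨x, hx, hxy⟩ => hsat x y hxy hx) (Set.subset_preimage_image π U)
  have hopen : IsOpen (π '' U) := hπ.isOpen_preimage.1 (himage.symm ▸ hU)
  filter_upwards [hφ (hopen.mem_nhds ⟨x₀, hx₀, rfl⟩)] with i hi
  exact himage.subset hi

theorem tendsto_comp_of_tendsto_quotient [TopologicalSpace Z] {F : X → Z} (hπ : IsQuotientMap π)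
    (hU : IsOpen U) (hsat : ∀ x y, π x = π y → x ∈ U → y ∈ U) (hF : ContinuousOn F U)
    (hinv : ∀ x y, π x = π y → x ∈ U → F y = F x) (hx₀ : x₀ ∈ U)
    (hφ : Tendsto (π ∘ φ) l (𝓝 (π x₀))) : Tendsto (F ∘ φ) l (𝓝 (F x₀)) := by
  refine tendsto_nhds.2 fun V hV hx₀V => ?_
  have hmem : ∀ᶠ i in l, φ i ∈ U ∩ F ⁻¹' V := by
    refine eventually_mem_of_tendsto_quotient hπ (hF.isOpen_inter_preimage hU hV) ?_ ⟨hx₀, hx₀V⟩ hφ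
    rintro x y hxy ⟨hxU, hxV⟩
    exact ⟨hsat x y hxy hxU, Set.mem_preimage.2 (hinv x y hxy hxU ▸ hxV)⟩
  exact hmem.mono fun i hi => hi.2

end Quotient

section Contraction

variable {n : ℕ}

instance neBot_comap_units : (comap (fun s : ℂˣ => (s : ℂ)) (𝓝 0)).NeBot := by
  refine comap_neBot_iff_frequently.2 ?_
  have hclosure : (0 : ℂ) ∈ closure {0}ᶜ := dense_compl_singleton 0 0
  exact (mem_closure_iff_frequently.1 hclosure).mono fun z hz => ⟨Units.mk0 z hz, rfl⟩

theorem tendsto_units_zpow {e : ℤ} (he : 0 < e) :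
    Tendsto (fun s : ℂˣ => ((s ^ e : ℂˣ) : ℂ)) (comap (fun s : ℂˣ => (s : ℂ)) (𝓝 0)) (𝓝 0) := by
  lift e to ℕ using he.le
  have hpow := (tendsto_comap (f := fun s : ℂˣ => (s : ℂ)) (x := 𝓝 0)).pow e
  rw [zero_pow (by omega)] at hpow
  simpa only [zpow_natCast, Units.val_pow_eq_pow_val] using hpow

theorem eq_zero_of_tendsto_units_zpow_mul {e : ℤ} (he : e < 0) {c : ℂ}
    (h : Tendsto (fun s : ℂˣ => ((s ^ e : ℂˣ) : ℂ) * c) (comap (fun s : ℂˣ => (s : ℂ)) (𝓝 0))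
      (𝓝 0)) : c = 0 := by
  have hconst := (tendsto_units_zpow (neg_pos.2 he)).mul h
  simp only [← mul_assoc, ← Units.val_mul, ← _root_.zpow_add, neg_add_cancel, zpow_zero,
    Units.val_one, one_mul, mul_zero] at hconst
  exact tendsto_nhds_unique tendsto_const_nhds hconst

theorem coefficients_one_of_ne {a b : Fin n} (hab : a ≠ b) (k : ℤ) :
    coefficients 1 a b k = 0 := by
  rw [coefficients, Matrix.SpecialLinearGroup.coe_one, Matrix.one_apply_ne hab,
    HahnSeries.coeff_zero]

theorem coefficients_conj_eval_eq_zpow_mul (η : AntidominantCocharacter n) (s : ℂˣ) (g : SL(n, 𝒦))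
    (a b : Fin n) (k : ℤ) : coefficients (MulAut.conj (η.eval s) g) a b k =
      ((s ^ (η.exponent a - η.exponent b) : ℂˣ) : ℂ) * coefficients g a b k := by
  rw [coefficients_conj_eval, zpow_sub, Units.val_mul]
  ring

theorem tendsto_coefficients_conj_eval_iff (η : AntidominantCocharacter n) (g : SL(n, 𝒦)) :
    Tendsto (fun s : ℂˣ => coefficients (MulAut.conj (η.eval s) g))
        (comap (fun s : ℂˣ => (s : ℂ)) (𝓝 0)) (𝓝 (coefficients 1)) ↔
      g ∈ lowerUnitriangular (Fin n) 𝒦 := by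
  simp only [tendsto_pi_nhds, coefficients_conj_eval_eq_zpow_mul]
  refine ⟨fun h a b hab => HahnSeries.ext (funext fun k => ?_), fun hg a b k => ?_⟩
  · have hlim := h a b k
    rcases hab.eq_or_lt with rfl | hlt
    · simp only [sub_self, zpow_zero, Units.val_one, one_mul] at hlim
      exact tendsto_nhds_unique tendsto_const_nhds hlim
    · rw [coefficients_one_of_ne hlt.ne] at hlim
      rw [Matrix.one_apply_ne hlt.ne, HahnSeries.coeff_zero]
      exact eq_zero_of_tendsto_units_zpow_mul (η.antidominant a b hlt) hlim
  · rcases le_or_gt a b with hab | hba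
    · have hone : coefficients g a b k = coefficients 1 a b k :=
        congrArg (HahnSeries.coeff · k) (hg a b hab)
      simp only [hone, ← coefficients_conj_eval_eq_zpow_mul, map_one, tendsto_const_nhds]
    · rw [coefficients_one_of_ne hba.ne']
      have hpos : 0 < η.exponent a - η.exponent b := by
        have hneg := η.antidominant b a hba
        omega
      simpa only [zero_mul] using (tendsto_units_zpow hpos).mul_const (coefficients g a b k)

end Contraction

/-! ### The image of a cell -/

section Cell

variable {n : ℕ}

/-- A representative of a point of the Bott-Samelson variety, continued by `1` to all indices. -/
def ParahoricProduct.toSequence {γ : Gallery n} (p : ParahoricProduct γ) (j : ℕ) : SL(n, 𝒦) :=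
  if h : j < γ.length + 1 then p ⟨j, h⟩ else 1

theorem ParahoricProduct.toSequence_fin {γ : Gallery n} (p : ParahoricProduct γ)
    (j : Fin (γ.length + 1)) : p.toSequence j = p j :=
  dif_pos j.2

theorem ParahoricProduct.toSequence_mem {γ : Gallery n} (p : ParahoricProduct γ) (j : ℕ) :
    p.toSequence j ∈ parahoric (vertex γ j) := by
  rw [toSequence]
  split_ifs with h
  · exact (p ⟨j, h⟩).2
  · exact one_mem _

theorem isInducing_coefficients (γ : Gallery n) :
    IsInducing fun (p : ParahoricProduct γ) (j : Fin (γ.length + 1)) =>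
      coefficients (p j : SL(n, 𝒦)) :=
  ⟨rfl⟩

theorem ParahoricProduct.continuous_coefficients_toSequence {γ : Gallery n} (j : ℕ) :
    Continuous fun p : ParahoricProduct γ => coefficients (p.toSequence j) := by
  by_cases h : j < γ.length + 1
  · simp only [toSequence, dif_pos h]
    exact continuous_pi_iff.1 (isInducing_coefficients γ).continuous ⟨j, h⟩
  · simp only [toSequence, dif_neg h, continuous_const]

/-- The componentwise conjugation by `η(s)`.  It represents the action of `η(s)` on the
Bott-Samelson variety and, in contrast to `torusActProduct`, fixes the base point `(1, …, 1)`. -/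
def torusConj (η : AntidominantCocharacter n) (s : ℂˣ) {γ : Gallery n} (p : ParahoricProduct γ) :
    ParahoricProduct γ := fun j =>
  ⟨MulAut.conj (η.eval s) (p j),
    mul_mem (mul_mem (η.eval_mem s _) (p j).2) (inv_mem (η.eval_mem s _))⟩

theorem toSequence_torusConj (η : AntidominantCocharacter n) (s : ℂˣ) {γ : Gallery n}
    (p : ParahoricProduct γ) :
    (torusConj η s p).toSequence = MulAut.conj (η.eval s) ∘ p.toSequence := by
  ext1 j
  rw [Function.comp_apply, ParahoricProduct.toSequence, ParahoricProduct.toSequence]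
  split_ifs
  · rfl
  · rw [map_one]

theorem vertex_succ_of_length_le {γ : Gallery n} {j : ℕ} (hj : γ.length ≤ j) :
    vertex γ (j + 1) = vertex γ j := by
  rw [vertex, vertex, List.take_of_length_le hj, List.take_of_length_le (by omega)]

theorem isMinusculeStep_vertex (γ : Gallery n) (j : ℕ) :
    IsMinusculeStep (vertex γ j) (vertex γ (j + 1)) := by
  intro a
  rcases lt_or_ge j γ.length with hj | hj
  · rw [vertex, vertex, List.take_add_one, List.getElem?_eq_getElem hj, Option.toList_some,
      List.map_append, List.sum_append, List.map_singleton, List.sum_singleton, Pi.add_apply,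
      columnCoweight]
    split_ifs <;> simp
  · exact Or.inl (congrFun (vertex_succ_of_length_le hj) a)

theorem segmentGroup_eq (γ : Gallery n) (j : ℕ) :
    segmentGroup γ j = parahoric (vertex γ j) ⊓ parahoric (vertex γ (j + 1)) := by
  rw [segmentGroup]
  split_ifs with hj
  · rfl
  · rw [vertex_succ_of_length_le (not_lt.1 hj), inf_idem]

theorem isQuotientMap_bottSamelsonMk (γ : Gallery n) :
    IsQuotientMap (BottSamelson.mk : ParahoricProduct γ → BottSamelson γ) :=
  ⟨⟨rfl⟩, Quotient.exists_rep⟩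

theorem torusAct_mk (η : AntidominantCocharacter n) (s : ℂˣ) {γ : Gallery n}
    (p : ParahoricProduct γ) :
    torusAct η s (BottSamelson.mk p) = BottSamelson.mk (torusConj η s p) := by
  have hmem : ∀ j, (η.eval s)⁻¹ ∈ segmentGroup γ j := fun j => by
    rw [segmentGroup_eq]
    exact inv_mem ⟨η.eval_mem s _, η.eval_mem s _⟩
  refine Quotient.sound ⟨fun j => ⟨_, hmem j⟩, ?_, fun j => ?_⟩
  · have hzero : torusActProduct η s p 0 = ⟨η.eval s, η.eval_mem s _⟩ * p 0 :=
      Function.update_self _ _ _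
    rw [hzero]
    rfl
  · have hsucc : torusActProduct η s p j.succ = p j.succ :=
      Function.update_of_ne (Fin.succ_ne_zero j) _ _
    rw [hsucc, inv_inv]
    rfl

theorem exists_toSequence_eq_of_mk_eq {γ : Gallery n} {p p' : ParahoricProduct γ}
    (h : BottSamelson.mk p = BottSamelson.mk p') : ∃ q : ℕ → SL(n, 𝒦),
      (∀ j, q j ∈ parahoric (vertex γ j) ⊓ parahoric (vertex γ (j + 1))) ∧
      p'.toSequence 0 = p.toSequence 0 * q 0 ∧
      ∀ j < γ.length, p'.toSequence (j + 1) = (q j)⁻¹ * p.toSequence (j + 1) * q (j + 1) := by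
  obtain ⟨q, hzero, hsucc⟩ := Quotient.exact h
  refine ⟨fun j => if hj : j < γ.length + 1 then q ⟨j, hj⟩ else 1, fun j => ?_, ?_, fun j hj => ?_⟩
  · rw [← segmentGroup_eq]
    dsimp only
    split_ifs with hj
    · exact (q ⟨j, hj⟩).2
    · exact one_mem _
  · exact hzero
  · simp only [ParahoricProduct.toSequence, dif_pos (Nat.succ_lt_succ hj),
      dif_pos (Nat.lt_succ_of_lt hj)]
    exact hsucc ⟨j, hj⟩

theorem loopAct_mul (g h : SL(n, 𝒦)) (x : AffineGrassmannian n) :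
    loopAct (g * h) x = loopAct g (loopAct h x) := by
  rw [loopAct, map_mul, mul_smul, loopAct, loopAct]

theorem desingularization_mk {γ : Gallery n} (p : ParahoricProduct γ) :
    desingularization γ (BottSamelson.mk p) =
      loopAct ((List.range (γ.length + 1)).map p.toSequence).prod
        (coweightPoint (vertex γ γ.length)) := by
  have hhead : headProduct p = ((List.range γ.length).map p.toSequence).prod := by
    rw [headProduct, Fin.partialProd]
    congr 1
    refine List.ext_getElem (by simp) fun j hj hj' => ?_
    simp [← p.toSequence_fin]
  rw [List.prod_range_succ, loopAct_mul, loopAct_coweightPoint _ _ (p.toSequence_mem γ.length),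
    ← hhead]
  rfl

/-- The representative `(1, …, 1)` of the torus fixed point corresponding to `γ`. -/
def basePoint (γ : Gallery n) : ParahoricProduct γ := fun _ => 1

theorem toSequence_basePoint (γ : Gallery n) : (basePoint γ).toSequence = 1 := by
  ext1 j
  rw [ParahoricProduct.toSequence]
  split_ifs <;> rfl

theorem mk_mem_cell_iff (η : AntidominantCocharacter n) {γ : Gallery n} {p : ParahoricProduct γ} :
    BottSamelson.mk p ∈ cell η γ ↔
      Tendsto (BottSamelson.mk ∘ fun s => torusConj η s p) (comap (fun s : ℂˣ => (s : ℂ)) (𝓝 0))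
        (𝓝 (BottSamelson.mk (basePoint γ))) :=
  tendsto_congr fun s => torusAct_mk η s p

theorem mk_mem_cell (η : AntidominantCocharacter n) {γ : Gallery n} {p : ParahoricProduct γ}
    (hp : ∀ j, (p j : SL(n, 𝒦)) ∈ lowerUnitriangular (Fin n) 𝒦) :
    BottSamelson.mk p ∈ cell η γ := by
  refine (mk_mem_cell_iff η).2 (((isQuotientMap_bottSamelsonMk γ).continuous.tendsto _).comp ?_)
  rw [(isInducing_coefficients γ).tendsto_nhds_iff, tendsto_pi_nhds]
  exact fun j => (tendsto_coefficients_conj_eval_iff η (p j)).2 (hp j)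

/-- The representatives of the points of the open chart around the base point. -/
def chartDomain (γ : Gallery n) : Set (ParahoricProduct γ) :=
  {p | InChart (vertex γ) p.toSequence γ.length}

theorem isOpen_chartDomain (γ : Gallery n) : IsOpen (chartDomain γ) :=
  isOpen_setOf_inChart (isMinusculeStep_vertex γ) ParahoricProduct.toSequence_mem
    ParahoricProduct.continuous_coefficients_toSequence _

theorem basePoint_mem_chartDomain (γ : Gallery n) : basePoint γ ∈ chartDomain γ := by
  rw [chartDomain, Set.mem_ofPred_eq, toSequence_basePoint]
  exact inChart_one (isMinusculeStep_vertex γ) _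

theorem torusConj_mem_chartDomain_iff (η : AntidominantCocharacter n) (s : ℂˣ) {γ : Gallery n}
    {p : ParahoricProduct γ} : torusConj η s p ∈ chartDomain γ ↔ p ∈ chartDomain γ := by
  rw [chartDomain, Set.mem_ofPred_eq, toSequence_torusConj, inChart_conj_eval_iff,
    Set.mem_ofPred_eq]

theorem mem_chartDomain_of_mk_eq {γ : Gallery n} (p p' : ParahoricProduct γ)
    (h : BottSamelson.mk p = BottSamelson.mk p') (hp : p ∈ chartDomain γ) : p' ∈ chartDomain γ := by
  obtain ⟨q, hq, hzero, hsucc⟩ := exists_toSequence_eq_of_mk_eq h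
  exact inChart_of_equivalent (isMinusculeStep_vertex γ) p.toSequence_mem hq hzero hsucc hp

theorem chart_eq_of_mk_eq {γ : Gallery n} {j : ℕ} (hj : j < γ.length) (p p' : ParahoricProduct γ)
    (h : BottSamelson.mk p = BottSamelson.mk p') (hp : p ∈ chartDomain γ) :
    chart (vertex γ) p'.toSequence j = chart (vertex γ) p.toSequence j := by
  obtain ⟨q, hq, hzero, hsucc⟩ := exists_toSequence_eq_of_mk_eq h
  exact chart_eq_of_equivalent (isMinusculeStep_vertex γ) p.toSequence_mem hq hzero hsucc hp hj

theorem mem_chartDomain_of_mk_mem_cell {η : AntidominantCocharacter n} {γ : Gallery n}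
    {p : ParahoricProduct γ} (hp : BottSamelson.mk p ∈ cell η γ) : p ∈ chartDomain γ := by
  have hevent := eventually_mem_of_tendsto_quotient (isQuotientMap_bottSamelsonMk γ)
    (isOpen_chartDomain γ) mem_chartDomain_of_mk_eq (basePoint_mem_chartDomain γ)
    ((mk_mem_cell_iff η).1 hp)
  obtain ⟨s, hs⟩ := hevent.exists
  exact (torusConj_mem_chartDomain_iff η s).1 hs

theorem chart_mem_lowerUnitriangular {η : AntidominantCocharacter n} {γ : Gallery n}
    {p : ParahoricProduct γ} (hp : BottSamelson.mk p ∈ cell η γ) {j : ℕ} (hj : j < γ.length) :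
    chart (vertex γ) p.toSequence j ∈ lowerUnitriangular (Fin n) 𝒦 := by
  have hlim := tendsto_comp_of_tendsto_quotient
    (F := fun p : ParahoricProduct γ => coefficients (chart (vertex γ) p.toSequence j))
    (isQuotientMap_bottSamelsonMk γ) (isOpen_chartDomain γ) mem_chartDomain_of_mk_eq
    (continuousOn_coefficients_chart (isMinusculeStep_vertex γ) ParahoricProduct.toSequence_mem
      ParahoricProduct.continuous_coefficients_toSequence hj)
    (fun p p' h hp => congrArg coefficients (chart_eq_of_mk_eq hj p p' h hp))
    (basePoint_mem_chartDomain γ) ((mk_mem_cell_iff η).1 hp)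
  rw [toSequence_basePoint, chart_one] at hlim
  rw [← tendsto_coefficients_conj_eval_iff η]
  simpa only [Function.comp_def, toSequence_torusConj, ← chart_conj_eval] using hlim

theorem desingularization_eq_prod_chart {γ : Gallery n} {p : ParahoricProduct γ}
    (hp : p ∈ chartDomain γ) :
    desingularization γ (BottSamelson.mk p) =
      loopAct ((List.range γ.length).map (chart (vertex γ) p.toSequence)).prod
        (coweightPoint (vertex γ γ.length)) := by
  rw [desingularization_mk, prod_eq_prod_chart_mul_straighten (vertex γ), loopAct_mul,
    loopAct_coweightPoint _ _ (straighten_mem (isMinusculeStep_vertex γ) p.toSequence_mem hp)]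

theorem cellImage_eq (η : AntidominantCocharacter n) (γ : Gallery n) :
    cellImage η γ = (fun g => loopAct g (coweightPoint (vertex γ γ.length))) ''
      pathProduct 0 (γ.map columnCoweight) := by
  have hvertex : ∀ j, 0 + ((γ.map columnCoweight).take j).sum = vertex γ j := fun j => by
    rw [zero_add, ← List.map_take, vertex]
  apply subset_antisymm
  · rintro _ ⟨x, hx, rfl⟩
    obtain ⟨p, rfl⟩ := (isQuotientMap_bottSamelsonMk γ).surjective x
    set c := chart (vertex γ) p.toSequence
    refine ⟨((List.range γ.length).map c).prod, mem_pathProduct_iff.2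
      ⟨fun j => if j < γ.length then c j else 1, fun j => ?_, ?_⟩,
      (desingularization_eq_prod_chart (mem_chartDomain_of_mk_mem_cell hx)).symm⟩
    · rw [hvertex]
      dsimp only
      split_ifs with hj
      · exact ⟨chart_mem_lowerUnitriangular hx hj, chart_mem _ _ j⟩
      · exact one_mem _
    · rw [List.length_map, List.prod_range_succ, if_neg (lt_irrefl _), mul_one]
      exact congrArg List.prod (List.map_congr_left fun j hj =>
        (if_pos (List.mem_range.1 hj)).symm)
  · rintro _ ⟨g, hg, rfl⟩
    obtain ⟨u, hu, rfl⟩ := mem_pathProduct_iff.1 hg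
    simp only [hvertex, List.length_map] at hu ⊢
    set p : ParahoricProduct γ := fun j => ⟨u j, (hu j).2⟩
    refine ⟨BottSamelson.mk p, mk_mem_cell η fun j => (hu j).1, ?_⟩
    rw [desingularization_mk]
    congr 2
    exact List.map_congr_left fun j hj => dif_pos (List.mem_range.1 hj)

end Cell

end LoopGallery

end

theorem mainTheorem3 (n : ℕ) (η : LoopGallery.AntidominantCocharacter n)
    (γ γ' : LoopGallery.Gallery n) (hw : γ.word = γ'.word) :
    LoopGallery.cellImage η γ = LoopGallery.cellImage η γ' := by
  rw [LoopGallery.cellImage_eq, LoopGallery.cellImage_eq, LoopGallery.vertex_length,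
    LoopGallery.vertex_length, LoopGallery.pathProduct_columnCoweight,
    LoopGallery.pathProduct_columnCoweight, hw]
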